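/- Let $F$ be a field of characteristic different from $2$, let $X$ be an abelian group, and let $D$ be the diagonalizable group over $F$ with character group $X$, so $F[D]=FX$. Let $g\in X$ with $g^2=1$, and let $x\in \mathrm{Lie}(D)$, i.e. $x:X\to F$ is a function with $x(h_1h_2)=x(h_1)+x(h_2)$. Let $D_{g,x}$ be the affine supergroup with coordinate Hopf superalgebra $F[D_{g,x}]=FX\oplus (FX)z$, where $z$ is odd, $z^2=0$, \[\Delta(h)=h\otimes h+x(h)\,hz\otimes hgz,\quad \Delta(z)=1\otimes z+z\otimes g,\quad \epsilon(h)=1,\ \epsilon(z)=0,\quad s(h)=h^{-1},\ s(z)=-g^{-1}z\qquad(h\in X).\] Let $D'\subseteq D$ be the kernel of the character $g:D\to\mu_2$, i.e. $F[D']=FX/FX(g-1)$; it is a purely even subsupergroup of $D_{g,x}$ via $h\mapsto h$, $z\mapsto 0$. For an affine supergroup $G$ and a finite-dimensional $G$-supermodule $V$ (a right $F[G]$-supercomodule) with homogeneous basis $v_i$ and coaction $\tau(v_i)=\sum_k v_k\otimes a_{ki}$, let $F[V]$ be the polynomial superalgebra freely generated by the dual basis $x_i$ (of parity $|x_i|=|v_i|$),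 with the coaction that is the superalgebra homomorphism $\tau:F[V]\to F[V]\otimes F[G]$ given by $\tau(x_i)=\sum_k x_k\otimes(-1)^{|v_k|(|v_i|+|v_k|)}s(a_{ik})$. Put $F[V]^G=\{f:\tau(f)=f\otimes 1\}$ and $M_{G,V}=\min\{d>0: F[V]^G_d\neq 0\}$, with $M_{G,V}=\infty$ if there is no such $d$. Let $V$ be a finite-dimensional $D_{g,x}$-supermodule. Then \[M_{D',V}\le M_{D_{g,x},V}\le 2M_{D',V}\] in each of the following two cases: (a) $D$ is connected (and $V$ is arbitrary); (b) $D$ is not necessarily connected, and $V^*\simeq L(h_1)\oplus\dots\oplus L(h_s)$ for some $s\ge 0$ and $h_1,\dots,h_s\in X$, that is, $V^*$ has a basis $f_{j,0}$ (even), $f_{j,1}$ (odd), $1\le j\le s$, such that $\tau(f_{j,0})=f_{j,0}\otimes h_j+x(h_j)f_{j,1}\otimes h_jgz$ and $\tau(f_{j,1})=f_{j,0}\otimes h_jz+f_{j,1}\otimes h_jg$. -/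

import Mathlib

open scoped TensorProduct DirectSum

noncomputable section

/-- A Hopf superalgebra over `F` on a given algebra and coalgebra `A`: a `ℤ/2`-grading for which `A`
is supercommutative, the counit and the comultiplication are homomorphisms of superalgebras (the
target `A ⊗ A` of the latter carries the multiplication
`(a ⊗ b)(c ⊗ d) = (-1)^{|b||c|} ac ⊗ bd`), together with a bijective antipode `s` which is an
endomorphism of superalgebras with `Δ s = t (s ⊗ s) Δ`, where `t` is the supersymmetry
`a ⊗ b ↦ (-1)^{|a||b|} b ⊗ a`. -/
structure HopfSuperalgebra (F A : Type*) [Field F] [Ring A] [Algebra F A] [Coalgebra F A] where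
  gr : ZMod 2 → Submodule F A
  gradedAlgebra : GradedAlgebra gr
  supercomm : ∀ (i j : ZMod 2) (a b : A), a ∈ gr i → b ∈ gr j →
    a * b = ((-1 : ℤˣ) ^ (i * j)) • (b * a)
  counit_one : Coalgebra.counit (R := F) (1 : A) = 1
  counit_mul : ∀ a b : A, Coalgebra.counit (R := F) (a * b) =
    Coalgebra.counit (R := F) a * Coalgebra.counit (R := F) b
  counit_odd : ∀ a ∈ gr 1, Coalgebra.counit (R := F) a = 0
  comul_even : ∀ (i : ZMod 2), ∀ a ∈ gr i, Coalgebra.comul (R := F) a ∈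
    ⨆ j : ZMod 2, Submodule.map₂ (TensorProduct.mk F A A) (gr j) (gr (i - j))
  comul_one : GradedTensorProduct.of F gr gr (Coalgebra.comul (R := F) (1 : A)) = 1
  comul_mul : ∀ a b : A, GradedTensorProduct.of F gr gr (Coalgebra.comul (R := F) (a * b)) =
    GradedTensorProduct.of F gr gr (Coalgebra.comul (R := F) a) *
      GradedTensorProduct.of F gr gr (Coalgebra.comul (R := F) b)
  antipode : A →ₐ[F] A
  antipode_even : ∀ (i : ZMod 2), ∀ a ∈ gr i, antipode a ∈ gr i
  antipode_bijective : Function.Bijective antipode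
  antipode_left : ∀ a : A, LinearMap.mul' F A
    (TensorProduct.map antipode.toLinearMap LinearMap.id (Coalgebra.comul (R := F) a)) =
      algebraMap F A (Coalgebra.counit (R := F) a)
  antipode_right : ∀ a : A, LinearMap.mul' F A
    (TensorProduct.map LinearMap.id antipode.toLinearMap (Coalgebra.comul (R := F) a)) =
      algebraMap F A (Coalgebra.counit (R := F) a)
  comul_antipode : ∀ a : A,
    GradedTensorProduct.of F gr gr (Coalgebra.comul (R := F) (antipode a)) =
      GradedTensorProduct.comm gr gr (GradedTensorProduct.of F gr gr
        (TensorProduct.map antipode.toLinearMap antipode.toLinearMap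
          (Coalgebra.comul (R := F) a)))

attribute [instance] HopfSuperalgebra.gradedAlgebra

/-- A pair `(g, x)` defining the supergroup `D_{g,x}`, where `D` is the diagonalizable group with
character group `X`: a character `g`, and an element `x` of `Lie(D)`, that is, an additive function
`X → F`, such that `g² = 1` if `x ≠ 0`. -/
structure SuperPair (F X : Type*) [Field F] [CommGroup X] where
  g : X
  x : Additive X →+ F
  sq_eq_one : x ≠ 0 → g ^ 2 = 1

/-- The coordinate superalgebra `F[D_{g,x}] = FX ⊕ (FX)z`, with `z` odd and `z² = 0`. -/
def CoordAlg {F X : Type*} [Field F] [CommGroup X] (_P : SuperPair F X) : Type _ :=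
  DualNumber (MonoidAlgebra F X)

namespace CoordAlg

variable {F X : Type*} [Field F] [CommGroup X] (P : SuperPair F X)

instance : CommRing (CoordAlg P) := inferInstanceAs (CommRing (DualNumber (MonoidAlgebra F X)))

instance : Algebra F (CoordAlg P) := inferInstanceAs (Algebra F (DualNumber (MonoidAlgebra F X)))

/-- The element `h` of `F[D_{g,x}]`, for `h ∈ X`. -/
def el (h : X) : CoordAlg P := TrivSqZeroExt.inl (MonoidAlgebra.single h (1 : F))

/-- The element `hz` of `F[D_{g,x}]`, for `h ∈ X`. -/
def elz (h : X) : CoordAlg P := TrivSqZeroExt.inr (MonoidAlgebra.single h (1 : F))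

/-- The linear map on `F[D_{g,x}]` with prescribed values on the basis of all `h` and `hz`. -/
def liftLin {N : Type*} [AddCommGroup N] [Module F N] (u v : X → N) : CoordAlg P →ₗ[F] N :=
  (Finsupp.linearCombination F u ∘ₗ (MonoidAlgebra.coeffLinearEquiv F).toLinearMap).coprod
    (Finsupp.linearCombination F v ∘ₗ (MonoidAlgebra.coeffLinearEquiv F).toLinearMap)

section
variable {N : Type*} [AddCommGroup N] [Module F N] (u v : X → N)

@[simp] theorem liftLin_el (h : X) : liftLin P u v (el P h) = u h := by
  have : liftLin P u v (el P h) = Finsupp.linearCombination F u (Finsupp.single h 1) +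
    Finsupp.linearCombination F v 0 := rfl
  simpa using this

@[simp] theorem liftLin_elz (h : X) : liftLin P u v (elz P h) = v h := by
  have : liftLin P u v (elz P h) = Finsupp.linearCombination F u 0 +
    Finsupp.linearCombination F v (Finsupp.single h 1) := rfl
  simpa using this

theorem induction {p : CoordAlg P → Prop} (h1 : ∀ h, p (el P h)) (h2 : ∀ h, p (elz P h))
    (h3 : ∀ a b, p a → p b → p (a + b)) (h4 : ∀ (c : F) a, p a → p (c • a)) (a : CoordAlg P) :
    p a := by
  have h0 : p 0 := by simpa using h4 0 _ (h1 1)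
  have e1 : ∀ r : MonoidAlgebra F X, p (TrivSqZeroExt.inl r : DualNumber (MonoidAlgebra F X)) := by
    intro r
    induction r using MonoidAlgebra.induction_linear with
    | zero => exact h0
    | add f g hf hg =>
      exact Eq.mpr (congrArg p (TrivSqZeroExt.inl_add (MonoidAlgebra F X) f g)) (h3 _ _ hf hg)
    | single h c =>
      have e : (MonoidAlgebra.single h c : MonoidAlgebra F X) = c • MonoidAlgebra.single h 1 := by
        rw [MonoidAlgebra.smul_single, smul_eq_mul, mul_one]
      rw [e]
      exact Eq.mpr (congrArg p (TrivSqZeroExt.inl_smul (MonoidAlgebra F X) c _)) (h4 c _ (h1 h))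
  have e2 : ∀ r : MonoidAlgebra F X, p (TrivSqZeroExt.inr r : DualNumber (MonoidAlgebra F X)) := by
    intro r
    induction r using MonoidAlgebra.induction_linear with
    | zero => exact h0
    | add f g hf hg =>
      exact Eq.mpr (congrArg p (TrivSqZeroExt.inr_add (MonoidAlgebra F X) f g)) (h3 _ _ hf hg)
    | single h c =>
      have e : (MonoidAlgebra.single h c : MonoidAlgebra F X) = c • MonoidAlgebra.single h 1 := by
        rw [MonoidAlgebra.smul_single, smul_eq_mul, mul_one]
      rw [e]
      exact Eq.mpr (congrArg p (TrivSqZeroExt.inr_smul (MonoidAlgebra F X) c _)) (h4 c _ (h2 h))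
  exact Eq.mp (congrArg p (TrivSqZeroExt.inl_fst_add_inr_snd_eq
    (R := MonoidAlgebra F X) (M := MonoidAlgebra F X) a))
    (h3 _ _ (e1 (TrivSqZeroExt.fst a)) (e2 (TrivSqZeroExt.snd a)))

variable {P} in
theorem lin_ext {f g : CoordAlg P →ₗ[F] N} (h1 : ∀ h, f (el P h) = g (el P h))
    (h2 : ∀ h, f (elz P h) = g (elz P h)) : f = g := by
  ext a
  induction a using CoordAlg.induction with
  | h1 h => exact h1 h
  | h2 h => exact h2 h
  | h3 a b ha hb => simp [ha, hb]
  | h4 c a ha => simp [ha]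

end

theorem one_eq : (1 : CoordAlg P) = el P 1 := rfl

theorem single_mul (h k : X) : (MonoidAlgebra.single (h * k) 1 : MonoidAlgebra F X) =
    MonoidAlgebra.single h 1 * MonoidAlgebra.single k 1 := by
  rw [MonoidAlgebra.single_mul_single, mul_one]

@[simp] theorem el_mul_el (h k : X) : el P h * el P k = el P (h * k) := by
  unfold el
  rw [single_mul]
  exact (TrivSqZeroExt.inl_mul (MonoidAlgebra F X) _ _).symm

@[simp] theorem el_mul_elz (h k : X) : el P h * elz P k = elz P (h * k) := by
  unfold el elz
  rw [single_mul]
  exact TrivSqZeroExt.inl_mul_inr (R := MonoidAlgebra F X) _ _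

@[simp] theorem elz_mul_el (h k : X) : elz P h * el P k = elz P (h * k) := by
  rw [mul_comm, el_mul_elz, mul_comm]

@[simp] theorem elz_mul_elz (h k : X) : elz P h * elz P k = 0 := 
  TrivSqZeroExt.inr_mul_inr _ _ _

/-- The comultiplication: `Δ(h) = h ⊗ h + x(h) hz ⊗ hgz` and `Δ(hz) = h ⊗ hz + hz ⊗ hg`, which
is `Δ(h)Δ(z)` for `Δ(z) = 1 ⊗ z + z ⊗ g`. -/
def comulLin : CoordAlg P →ₗ[F] CoordAlg P ⊗[F] CoordAlg P :=
  liftLin P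
    (fun h => el P h ⊗ₜ el P h + P.x (Additive.ofMul h) • (elz P h ⊗ₜ elz P (h * P.g)))
    (fun h => el P h ⊗ₜ elz P h + elz P h ⊗ₜ el P (h * P.g))

/-- The counit: `ε(h) = 1` and `ε(hz) = 0`. -/
def counitLin : CoordAlg P →ₗ[F] F := liftLin P (fun _ => 1) (fun _ => 0)

variable [NeZero (2 : F)]

theorem g_cases : P.x = 0 ∨ (P.g * P.g = 1 ∧ P.x (Additive.ofMul P.g) = 0) := by
  by_cases hx : P.x = 0
  · exact Or.inl hx
  · have h := P.sq_eq_one hx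
    rw [pow_two] at h
    refine Or.inr ⟨h, ?_⟩
    have h2 : (2 : F) * P.x (Additive.ofMul P.g) = 0 := by
      rw [two_mul, ← map_add, ← ofMul_mul, h, ofMul_one, map_zero]
    exact (mul_eq_zero.mp h2).resolve_left (NeZero.ne 2)

instance : Coalgebra F (CoordAlg P) where
  comul := comulLin P
  counit := counitLin P
  coassoc := by
    rcases g_cases P with hx | ⟨hg, hx⟩
    · refine lin_ext (fun h => ?_) (fun h => ?_)
      · simp [comulLin, hx]
      · simp [comulLin, hx, TensorProduct.add_tmul, TensorProduct.tmul_add, add_assoc]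
    · refine lin_ext (fun h => ?_) (fun h => ?_)
      · simp [comulLin, TensorProduct.add_tmul, TensorProduct.tmul_add, 
          ← TensorProduct.smul_tmul', mul_assoc, hg]
        abel
      · simp [comulLin, TensorProduct.add_tmul, TensorProduct.tmul_add, 
          ← TensorProduct.smul_tmul', mul_assoc, hg, hx]
        abel
  rTensor_counit_comp_comul := by
    refine lin_ext (fun h => ?_) (fun h => ?_) <;> simp [comulLin, counitLin]
  lTensor_counit_comp_comul := by
    refine lin_ext (fun h => ?_) (fun h => ?_) <;> simp [comulLin, counitLin]

@[simp] theorem comul_el (h : X) : Coalgebra.comul (R := F) (el P h) =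
    el P h ⊗ₜ el P h + P.x (Additive.ofMul h) • (elz P h ⊗ₜ elz P (h * P.g)) :=
  liftLin_el P _ _ h

@[simp] theorem comul_elz (h : X) : Coalgebra.comul (R := F) (elz P h) =
    el P h ⊗ₜ[F] elz P h + elz P h ⊗ₜ el P (h * P.g) :=
  liftLin_elz P _ _ h

@[simp] theorem counit_el (h : X) : Coalgebra.counit (R := F) (el P h) = 1 :=
  liftLin_el P _ _ h

@[simp] theorem counit_elz (h : X) : Coalgebra.counit (R := F) (elz P h) = 0 :=
  liftLin_elz P _ _ h

end CoordAlg

/-- The multiplication of the graded tensor product, on elements given with their degrees. -/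
theorem gradedTensor_mul {F A B : Type*} [Field F] [Ring A] [Ring B] [Algebra F A] [Algebra F B]
    (𝒜 : ZMod 2 → Submodule F A) (ℬ : ZMod 2 → Submodule F B) [GradedAlgebra 𝒜] [GradedAlgebra ℬ]
    {i j : ZMod 2} (a₁ : A) {b₁ : B} (hb : b₁ ∈ ℬ j) {a₂ : A} (ha : a₂ ∈ 𝒜 i) (b₂ : B) :
    GradedTensorProduct.of F 𝒜 ℬ (a₁ ⊗ₜ b₁) * GradedTensorProduct.of F 𝒜 ℬ (a₂ ⊗ₜ b₂) =
      ((-1 : ℤˣ) ^ (j * i)) • GradedTensorProduct.of F 𝒜 ℬ ((a₁ * a₂) ⊗ₜ (b₁ * b₂)) :=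
  GradedTensorProduct.tmul_coe_mul_coe_tmul 𝒜 ℬ a₁ ⟨b₁, hb⟩ ⟨a₂, ha⟩ b₂

namespace CoordAlg

variable {F X : Type*} [Field F] [CommGroup X] (P : SuperPair F X)

/-- The basis of the even (`i = 0`) and of the odd (`i = 1`) part. -/
def bas (i : ZMod 2) (h : X) : CoordAlg P := if i = 0 then el P h else elz P h

/-- The even part is `FX` and the odd part is `(FX)z`. -/
def gr (i : ZMod 2) : Submodule F (CoordAlg P) := Submodule.span F (Set.range (bas P i))

theorem el_mem (h : X) : el P h ∈ gr P 0 := Submodule.subset_span ⟨h, rfl⟩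

theorem elz_mem (h : X) : elz P h ∈ gr P 1 := Submodule.subset_span ⟨h, rfl⟩

theorem zmod2_cases (i : ZMod 2) : i = 0 ∨ i = 1 := by
  revert i; decide

theorem gr_induction {i : ZMod 2} {p : ZMod 2 → CoordAlg P → Prop}
    (h1 : ∀ h, p 0 (el P h)) (h2 : ∀ h, p 1 (elz P h)) (h0 : ∀ i, p i 0)
    (h3 : ∀ i a b, p i a → p i b → p i (a + b)) (h4 : ∀ i (c : F) a, p i a → p i (c • a))
    {a : CoordAlg P} (ha : a ∈ gr P i) : p i a := by
  refine Submodule.span_induction ?_ (h0 i) (fun a b _ _ => h3 i a b) (fun c a _ => h4 i c a) ha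
  rintro _ ⟨h, rfl⟩
  rcases zmod2_cases i with rfl | rfl
  · exact h1 h
  · exact h2 h

instance : SetLike.GradedMonoid (gr P) where
  one_mem := el_mem P 1
  mul_mem i j a b ha hb := by
    refine gr_induction P (p := fun i a => a * b ∈ gr P (i + j)) ?_ ?_ ?_ ?_ ?_ ha
    · intro h
      refine gr_induction P (p := fun j b => el P h * b ∈ gr P (0 + j)) ?_ ?_ ?_ ?_ ?_ hb
      · intro k; rw [el_mul_el]; exact el_mem P _
      · intro k; rw [el_mul_elz]; exact elz_mem P _
      · intro i; simp
      · intro i a b h1 h2; rw [mul_add]; exact add_mem h1 h2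
      · intro i c a h1; rw [mul_smul_comm]; exact Submodule.smul_mem _ _ h1
    · intro h
      refine gr_induction P (p := fun j b => elz P h * b ∈ gr P (1 + j)) ?_ ?_ ?_ ?_ ?_ hb
      · intro k; rw [elz_mul_el]; exact elz_mem P _
      · intro k; rw [elz_mul_elz]; exact zero_mem _
      · intro i; simp
      · intro i a b h1 h2; rw [mul_add]; exact add_mem h1 h2
      · intro i c a h1; rw [mul_smul_comm]; exact Submodule.smul_mem _ _ h1
    · intro i; simp
    · intro i a b h1 h2; rw [add_mul]; exact add_mem h1 h2
    · intro i c a h1; rw [smul_mul_assoc]; exact Submodule.smul_mem _ _ h1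

/-- The decomposition of an element into its even and odd parts. -/
def decomp : CoordAlg P →ₗ[F] ⨁ i, gr P i :=
  liftLin P (fun h => DirectSum.lof F (ZMod 2) (fun i => gr P i) 0 ⟨el P h, el_mem P h⟩)
    (fun h => DirectSum.lof F (ZMod 2) (fun i => gr P i) 1 ⟨elz P h, elz_mem P h⟩)

theorem decomp_mem {i : ZMod 2} {a : CoordAlg P} (ha : a ∈ gr P i) :
    decomp P a = DirectSum.lof F (ZMod 2) (fun i => gr P i) i ⟨a, ha⟩ := by
  have := gr_induction P (p := fun i a => ∃ ha : a ∈ gr P i,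
    decomp P a = DirectSum.lof F (ZMod 2) (fun i => gr P i) i ⟨a, ha⟩) ?_ ?_ ?_ ?_ ?_ ha
  · exact this.2
  · exact fun h => ⟨el_mem P h, liftLin_el P _ _ h⟩
  · exact fun h => ⟨elz_mem P h, liftLin_elz P _ _ h⟩
  · exact fun i => ⟨zero_mem _, by rw [map_zero]; exact (map_zero _).symm⟩
  · rintro i a b ⟨h1, e1⟩ ⟨h2, e2⟩
    refine ⟨add_mem h1 h2, ?_⟩
    rw [map_add, e1, e2, ← map_add]; rfl
  · rintro i c a ⟨h1, e1⟩
    refine ⟨Submodule.smul_mem _ c h1, ?_⟩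
    rw [map_smul, e1, ← map_smul]; rfl

instance : DirectSum.Decomposition (gr P) :=
  DirectSum.Decomposition.ofLinearMap (gr P) (decomp P)
    (by
      refine lin_ext (fun h => ?_) (fun h => ?_)
      · simp [decomp]
      · simp [decomp])
    (by
      ext i ⟨a, ha⟩ : 2
      simpa using decomp_mem P ha)

instance : GradedAlgebra (gr P) where

/-- The antipode: `s(h) = h⁻¹` and `s(hz) = - (hg)⁻¹ z`, that is, `s(z) = - g⁻¹ z`. -/
def antipodeLin : CoordAlg P →ₗ[F] CoordAlg P :=
  liftLin P (fun h => el P h⁻¹) (fun h => - elz P (h * P.g)⁻¹)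

@[simp] theorem antipodeLin_el (h : X) : antipodeLin P (el P h) = el P h⁻¹ :=
  liftLin_el P _ _ h

@[simp] theorem antipodeLin_elz (h : X) : antipodeLin P (elz P h) = - elz P (h * P.g)⁻¹ :=
  liftLin_elz P _ _ h

/-- A bilinear identity on `F[D_{g,x}]` can be checked on the basis. -/
theorem bilin_ext {N : Type*} [AddCommGroup N] [Module F N]
    {f g : CoordAlg P →ₗ[F] CoordAlg P →ₗ[F] N}
    (h1 : ∀ h k, f (el P h) (el P k) = g (el P h) (el P k))
    (h2 : ∀ h k, f (el P h) (elz P k) = g (el P h) (elz P k))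
    (h3 : ∀ h k, f (elz P h) (el P k) = g (elz P h) (el P k))
    (h4 : ∀ h k, f (elz P h) (elz P k) = g (elz P h) (elz P k)) (a b : CoordAlg P) :
    f a b = g a b := by
  have : f = g := lin_ext (fun h => lin_ext (h1 h) (h2 h)) (fun h => lin_ext (h3 h) (h4 h))
  rw [this]

theorem antipodeLin_mul (a b : CoordAlg P) :
    antipodeLin P (a * b) = antipodeLin P a * antipodeLin P b :=
  bilin_ext P (f := (LinearMap.mul F (CoordAlg P)).compr₂ (antipodeLin P))
    (g := (LinearMap.mul F (CoordAlg P)).compl₁₂ (antipodeLin P) (antipodeLin P))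
    (fun h k => by simp [mul_comm]) (fun h k => by simp [mul_comm, mul_left_comm])
    (fun h k => by simp [mul_comm, mul_left_comm]) (fun h k => by simp) a b

/-- The antipode as an endomorphism of algebras. -/
def antipodeHom : CoordAlg P →ₐ[F] CoordAlg P :=
  AlgHom.ofLinearMap (antipodeLin P) (by rw [one_eq]; simp) (antipodeLin_mul P)

theorem antipodeLin_antipodeLin (a : CoordAlg P) : antipodeLin P (antipodeLin P a) = a := by
  induction a using CoordAlg.induction with
  | h1 h => simp
  | h2 h => simp
  | h3 a b ha hb => simp [ha, hb]
  | h4 c a ha => simp [ha]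

variable [NeZero (2 : F)]

theorem comul_mul (a b : CoordAlg P) :
    GradedTensorProduct.of F (gr P) (gr P) (Coalgebra.comul (R := F) (a * b)) =
      GradedTensorProduct.of F (gr P) (gr P) (Coalgebra.comul (R := F) a) *
        GradedTensorProduct.of F (gr P) (gr P) (Coalgebra.comul (R := F) b) := by
  refine bilin_ext P
    (f := (LinearMap.mul F (CoordAlg P)).compr₂
      ((GradedTensorProduct.of F (gr P) (gr P)).toLinearMap ∘ₗ Coalgebra.comul))
    (g := (LinearMap.mul F (GradedTensorProduct F (gr P) (gr P))).compl₁₂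
      ((GradedTensorProduct.of F (gr P) (gr P)).toLinearMap ∘ₗ Coalgebra.comul)
      ((GradedTensorProduct.of F (gr P) (gr P)).toLinearMap ∘ₗ Coalgebra.comul)) ?_ ?_ ?_ ?_ a b
  all_goals
    intro h k
    simp only [LinearMap.compr₂_apply, LinearMap.compl₁₂_apply, LinearMap.mul_apply',
      LinearMap.comp_apply, LinearEquiv.coe_coe, comul_el, comul_elz, map_add, map_smul, add_mul,
      mul_add, smul_mul_assoc, mul_smul_comm, el_mul_el, el_mul_elz, elz_mul_el, elz_mul_elz,
      LinearMap.add_apply, LinearMap.smul_apply,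
      gradedTensor_mul (gr P) (gr P) _ (el_mem P _) (el_mem P _),
      gradedTensor_mul (gr P) (gr P) _ (el_mem P _) (elz_mem P _),
      gradedTensor_mul (gr P) (gr P) _ (elz_mem P _) (el_mem P _),
      gradedTensor_mul (gr P) (gr P) _ (elz_mem P _) (elz_mem P _)]
    simp only [zero_mul, mul_zero, one_mul, uzpow_zero, one_smul, uzpow_one, TensorProduct.tmul_zero,
      smul_zero, add_zero, zero_add, map_zero, ofMul_mul, map_add, add_smul, TensorProduct.zero_tmul,
      mul_right_comm _ P.g, ← mul_assoc, Units.neg_smul, neg_add_cancel, add_neg_cancel]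
    try abel

/-- The Hopf superalgebra `F[D_{g,x}]`. -/
def hopf : HopfSuperalgebra F (CoordAlg P) where
  gr := gr P
  gradedAlgebra := inferInstance
  supercomm i j a b ha hb := by
    refine gr_induction P (p := fun i a => a * b = ((-1 : ℤˣ) ^ (i * j)) • (b * a))
      ?_ ?_ ?_ ?_ ?_ ha
    · intro h; simp [mul_comm]
    · intro h
      refine gr_induction P (p := fun j b => elz P h * b = ((-1 : ℤˣ) ^ (1 * j)) • (b * elz P h))
        ?_ ?_ ?_ ?_ ?_ hb
      · intro k; simp [mul_comm]
      · intro k; simp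
      · intro i; simp
      · intro i a b h1 h2; rw [mul_add, add_mul, h1, h2, smul_add]
      · intro i c a h1; rw [mul_smul_comm, smul_mul_assoc, h1, smul_comm]
    · intro i; simp
    · intro i a b h1 h2; rw [mul_add, add_mul, h1, h2, smul_add]
    · intro i c a h1; rw [mul_smul_comm, smul_mul_assoc, h1, smul_comm]
  counit_one := counit_el P 1
  counit_mul a b := bilin_ext P
    (f := (LinearMap.mul F (CoordAlg P)).compr₂ Coalgebra.counit)
    (g := (LinearMap.mul F F).compl₁₂ Coalgebra.counit Coalgebra.counit)
    (fun h k => by simp) (fun h k => by simp) (fun h k => by simp) (fun h k => by simp) a b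
  counit_odd a ha := by
    refine gr_induction P (p := fun i a => i = 1 → Coalgebra.counit (R := F) a = 0)
      ?_ ?_ ?_ ?_ ?_ ha rfl
    · intro h h0; exact absurd h0 (by decide)
    · intro h _; simp
    · intro i _; simp
    · intro i a b h1 h2 hi; rw [map_add, h1 hi, h2 hi, add_zero]
    · intro i c a h1 hi; rw [map_smul, h1 hi, smul_zero]
  comul_even i a ha := by
    refine gr_induction P (p := fun i a => Coalgebra.comul (R := F) a ∈ ⨆ j : ZMod 2,
      Submodule.map₂ (TensorProduct.mk F (CoordAlg P) (CoordAlg P)) (gr P j) (gr P (i - j)))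
      ?_ ?_ ?_ ?_ ?_ ha
    · intro h
      rw [comul_el]
      refine add_mem ?_ (Submodule.smul_mem _ _ ?_)
      · exact Submodule.mem_iSup_of_mem 0 (Submodule.apply_mem_map₂ _ (el_mem P h) (el_mem P h))
      · exact Submodule.mem_iSup_of_mem 1 (Submodule.apply_mem_map₂ _ (elz_mem P h) (elz_mem P _))
    · intro h
      rw [comul_elz]
      refine add_mem ?_ ?_
      · exact Submodule.mem_iSup_of_mem 0 (Submodule.apply_mem_map₂ _ (el_mem P h) (elz_mem P h))
      · exact Submodule.mem_iSup_of_mem 1 (Submodule.apply_mem_map₂ _ (elz_mem P h) (el_mem P _))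
    · intro i; simp
    · intro i a b h1 h2; rw [map_add]; exact add_mem h1 h2
    · intro i c a h1; rw [map_smul]; exact Submodule.smul_mem _ _ h1
  comul_one := by
    rw [one_eq, comul_el]
    simp only [ofMul_one, map_zero, zero_smul, add_zero]
    rfl
  comul_mul := comul_mul P
  antipode := antipodeHom P
  antipode_even i a ha := by
    refine gr_induction P (p := fun i a => antipodeLin P a ∈ gr P i) ?_ ?_ ?_ ?_ ?_ ha
    · intro h; rw [antipodeLin_el]; exact el_mem P _
    · intro h; rw [antipodeLin_elz]; exact neg_mem (elz_mem P _)
    · intro i; simp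
    · intro i a b h1 h2; rw [map_add]; exact add_mem h1 h2
    · intro i c a h1; rw [map_smul]; exact Submodule.smul_mem _ _ h1
  antipode_bijective := Function.Involutive.bijective (antipodeLin_antipodeLin P)
  antipode_left a := by
    have e : (antipodeHom P).toLinearMap = antipodeLin P := rfl
    rw [e]
    induction a using CoordAlg.induction with
    | h1 h => simp [one_eq]
    | h2 h => simp
    | h3 a b ha hb => simp only [map_add, ha, hb]
    | h4 c a ha => rw [map_smul, map_smul, map_smul, ha, map_smul, smul_eq_mul, map_mul,
        Algebra.smul_def]
  antipode_right a := by
    have e : (antipodeHom P).toLinearMap = antipodeLin P := rfl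
    rw [e]
    induction a using CoordAlg.induction with
    | h1 h => simp [one_eq]
    | h2 h => simp [mul_comm]
    | h3 a b ha hb => simp only [map_add, ha, hb]
    | h4 c a ha => rw [map_smul, map_smul, map_smul, ha, map_smul, smul_eq_mul, map_mul,
        Algebra.smul_def]
  comul_antipode a := by
    have e : (antipodeHom P).toLinearMap = antipodeLin P := rfl
    have e' : ∀ a, antipodeHom P a = antipodeLin P a := fun _ => rfl
    have c00 : ∀ h k, GradedTensorProduct.comm (gr P) (gr P) (GradedTensorProduct.of F (gr P) (gr P)
        (el P h ⊗ₜ el P k)) = GradedTensorProduct.of F (gr P) (gr P) (el P k ⊗ₜ el P h) :=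
      fun h k => by
        simpa using GradedTensorProduct.comm_coe_tmul_coe (gr P) (gr P)
          ⟨_, el_mem P h⟩ ⟨_, el_mem P k⟩
    have c01 : ∀ h k, GradedTensorProduct.comm (gr P) (gr P) (GradedTensorProduct.of F (gr P) (gr P)
        (el P h ⊗ₜ elz P k)) = GradedTensorProduct.of F (gr P) (gr P) (elz P k ⊗ₜ el P h) :=
      fun h k => by
        simpa using GradedTensorProduct.comm_coe_tmul_coe (gr P) (gr P)
          ⟨_, el_mem P h⟩ ⟨_, elz_mem P k⟩
    have c10 : ∀ h k, GradedTensorProduct.comm (gr P) (gr P) (GradedTensorProduct.of F (gr P) (gr P)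
        (elz P h ⊗ₜ el P k)) = GradedTensorProduct.of F (gr P) (gr P) (el P k ⊗ₜ elz P h) :=
      fun h k => by
        simpa using GradedTensorProduct.comm_coe_tmul_coe (gr P) (gr P)
          ⟨_, elz_mem P h⟩ ⟨_, el_mem P k⟩
    have c11 : ∀ h k, GradedTensorProduct.comm (gr P) (gr P) (GradedTensorProduct.of F (gr P) (gr P)
        (elz P h ⊗ₜ elz P k)) = - GradedTensorProduct.of F (gr P) (gr P) (elz P k ⊗ₜ elz P h) :=
      fun h k => by
        simpa using GradedTensorProduct.comm_coe_tmul_coe (gr P) (gr P)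
          ⟨_, elz_mem P h⟩ ⟨_, elz_mem P k⟩
    rw [e, e']
    induction a using CoordAlg.induction with
    | h1 h =>
      rcases g_cases P with hx | ⟨hg, hx⟩
      · simp [hx, c00]
      · simp [c00, c11, TensorProduct.neg_tmul, TensorProduct.tmul_neg, mul_assoc, hg, inv_eq_of_mul_eq_one_left hg, mul_comm P.g]
    | h2 h => simp [c01, c10, TensorProduct.neg_tmul, TensorProduct.tmul_neg]
    | h3 a b ha hb => simp only [map_add, ha, hb]
    | h4 c a ha => simp only [map_smul, ha]

end CoordAlg

namespace PurelyEven

variable (F B : Type*) [Field F] [CommRing B] [HopfAlgebra F B]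

/-- The trivial grading: everything is even. -/
def gr (i : ZMod 2) : Submodule F B := if i = 0 then ⊤ else ⊥

theorem mem_zero (b : B) : b ∈ gr F B 0 := Submodule.mem_top

theorem gr_cases {i : ZMod 2} {b : B} (hb : b ∈ gr F B i) : i = 0 ∨ b = 0 := by
  unfold gr at hb
  split_ifs at hb with h
  · exact Or.inl h
  · exact Or.inr hb

instance : SetLike.GradedMonoid (gr F B) where
  one_mem := mem_zero F B 1
  mul_mem i j a b ha hb := by
    rcases gr_cases F B ha with rfl | rfl
    · rcases gr_cases F B hb with rfl | rfl
      · exact mem_zero F B _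
      · simp
    · simp

instance : DirectSum.Decomposition (gr F B) :=
  DirectSum.Decomposition.ofLinearMap (gr F B)
    (DirectSum.lof F (ZMod 2) (fun i => gr F B i) 0 ∘ₗ
      LinearMap.codRestrict (gr F B 0) LinearMap.id (mem_zero F B))
    (by ext b; simp)
    (by
      ext i ⟨b, hb⟩ : 2
      rcases gr_cases F B hb with rfl | rfl
      · simp; rfl
      · simp only [LinearMap.comp_apply, DirectSum.coeLinearMap_lof]
        exact map_zero (DirectSum.lof F (ZMod 2) (fun i => gr F B i) 0) |>.trans
          (map_zero (DirectSum.lof F (ZMod 2) (fun i => gr F B i) i)).symm)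

instance : GradedAlgebra (gr F B) where

theorem of_mul (u v : B ⊗[F] B) : GradedTensorProduct.of F (gr F B) (gr F B) (u * v) =
    GradedTensorProduct.of F (gr F B) (gr F B) u * GradedTensorProduct.of F (gr F B) (gr F B) v := by
  induction u using TensorProduct.induction_on with
  | zero => simp
  | add u u' hu hu' => rw [add_mul, map_add, hu, hu', map_add, add_mul]
  | tmul a b =>
    induction v using TensorProduct.induction_on with
    | zero => simp
    | add v v' hv hv' => rw [mul_add, map_add, hv, hv', map_add, mul_add]
    | tmul c d =>
      rw [gradedTensor_mul (gr F B) (gr F B) _ (mem_zero F B b) (mem_zero F B c)]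
      simp

theorem of_comm (u : B ⊗[F] B) :
    GradedTensorProduct.comm (gr F B) (gr F B) (GradedTensorProduct.of F (gr F B) (gr F B) u) =
      GradedTensorProduct.of F (gr F B) (gr F B) (TensorProduct.comm F B B u) := by
  induction u using TensorProduct.induction_on with
  | zero => simp
  | add u u' hu hu' => simp only [map_add, hu, hu']
  | tmul a b =>
    simpa using GradedTensorProduct.comm_coe_tmul_coe (gr F B) (gr F B)
      ⟨a, mem_zero F B a⟩ ⟨b, mem_zero F B b⟩

/-- A commutative Hopf algebra, viewed as a purely even Hopf superalgebra. (The two properties of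
the antipode hold for every commutative Hopf algebra.) -/
def hopf (h1 : ∀ b : B, HopfAlgebra.antipode F (HopfAlgebra.antipode F b) = b)
    (h2 : ∀ b : B, Coalgebra.comul (R := F) (HopfAlgebra.antipode F b) = TensorProduct.comm F B B
      (TensorProduct.map (HopfAlgebra.antipode F) (HopfAlgebra.antipode F)
        (Coalgebra.comul (R := F) b))) : HopfSuperalgebra F B where
  gr := gr F B
  gradedAlgebra := inferInstance
  supercomm i j a b ha hb := by
    rcases gr_cases F B ha with rfl | rfl
    · simp [mul_comm]
    · simp
  counit_one := Bialgebra.counit_one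
  counit_mul := Bialgebra.counit_mul
  counit_odd a ha := by
    rcases gr_cases F B ha with h | rfl
    · exact absurd h (by decide)
    · simp
  comul_even i a ha := by
    rcases gr_cases F B ha with rfl | rfl
    · refine Submodule.mem_iSup_of_mem 0 ?_
      generalize Coalgebra.comul (R := F) a = u
      induction u using TensorProduct.induction_on with
      | zero => exact zero_mem _
      | add u v hu hv => exact add_mem hu hv
      | tmul a b => exact Submodule.apply_mem_map₂ _ (mem_zero F B a) (mem_zero F B b)
    · simp
  comul_one := by rw [Bialgebra.comul_one]; rfl
  comul_mul a b := by rw [Bialgebra.comul_mul, of_mul]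
  antipode := HopfAlgebra.antipodeAlgHom F B
  antipode_even i a ha := by
    rcases gr_cases F B ha with rfl | rfl
    · exact mem_zero F B _
    · simp
  antipode_bijective := Function.Involutive.bijective (f := HopfAlgebra.antipode F) h1
  antipode_left a := HopfAlgebra.mul_antipode_rTensor_comul_apply a
  antipode_right a := HopfAlgebra.mul_antipode_lTensor_comul_apply a
  comul_antipode a := by
    rw [of_comm]
    exact congrArg _ (h2 a)

end PurelyEven

namespace SuperPair

variable {F X : Type*} [Field F] [CommGroup X] (P : SuperPair F X)

/-- The ideal `FX(g - 1)` of `FX = F[D]`. -/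
def kerIdeal : Ideal (MonoidAlgebra F X) :=
  Ideal.span {MonoidAlgebra.single P.g (1 : F) - 1}

instance : Ideal.IsHopfIdeal F P.kerIdeal where
  counit_eq_zero x hx := by
    have h : P.kerIdeal ≤ RingHom.ker (Bialgebra.counitAlgHom F (MonoidAlgebra F X)) := by
      rw [kerIdeal, Ideal.span_le, Set.singleton_subset_iff]
      change Bialgebra.counitAlgHom F (MonoidAlgebra F X) _ = 0
      rw [map_sub, map_one]
      simp
    exact h hx
  map_mkQ_comul_eq_zero x hx := by
    have h : P.kerIdeal ≤ RingHom.ker ((Algebra.TensorProduct.map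
        (Ideal.Quotient.mkₐ F P.kerIdeal) (Ideal.Quotient.mkₐ F P.kerIdeal)).comp
        (Bialgebra.comulAlgHom F (MonoidAlgebra F X))) := by
      have e : Ideal.Quotient.mkₐ F P.kerIdeal (MonoidAlgebra.single P.g (1 : F)) = 1 := by
        rw [← sub_eq_zero, ← map_one (Ideal.Quotient.mkₐ F P.kerIdeal), ← map_sub]
        exact Ideal.Quotient.eq_zero_iff_mem.mpr (Ideal.subset_span rfl)
      conv_lhs => rw [kerIdeal]
      rw [Ideal.span_le, Set.singleton_subset_iff]
      change AlgHom.comp _ _ _ = 0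
      rw [map_sub, map_one, AlgHom.comp_apply, Bialgebra.comulAlgHom_apply,
        MonoidAlgebra.comul_single, CommSemiring.comul_apply, TensorProduct.map_tmul,
        MonoidAlgebra.lsingle_apply, Algebra.TensorProduct.map_tmul, e]
      exact sub_self _
    exact h hx
  antipode_mem x hx := by
    have h : P.kerIdeal ≤ Ideal.comap (HopfAlgebra.antipodeAlgHom F (MonoidAlgebra F X))
        P.kerIdeal := by
      conv_lhs => rw [kerIdeal]
      rw [Ideal.span_le, Set.singleton_subset_iff]
      change HopfAlgebra.antipodeAlgHom F (MonoidAlgebra F X) _ ∈ P.kerIdeal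
      have e : HopfAlgebra.antipodeAlgHom F (MonoidAlgebra F X)
          (MonoidAlgebra.single P.g (1 : F) - 1) =
          (- MonoidAlgebra.single P.g⁻¹ (1 : F)) * (MonoidAlgebra.single P.g (1 : F) - 1) := by
        rw [map_sub, map_one, mul_sub, mul_one, neg_mul, MonoidAlgebra.single_mul_single,
          inv_mul_cancel, mul_one, ← MonoidAlgebra.one_def]
        change HopfAlgebra.antipode F (MonoidAlgebra.single P.g (1 : F)) - 1 = _
        rw [MonoidAlgebra.antipode_single]
        simp
        ring
      rw [e]
      exact Ideal.mul_mem_left _ _ (Ideal.subset_span rfl)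
    exact h hx

/-- The coordinate algebra `F[D'] = FX / FX(g - 1)` of the kernel `D' ⊆ D` of the character `g`. -/
abbrev KerCoord : Type _ := MonoidAlgebra F X ⧸ P.kerIdeal

theorem kerCoord_induction {p : P.KerCoord → Prop}
    (h1 : ∀ h : X, p (Ideal.Quotient.mk P.kerIdeal (MonoidAlgebra.single h 1)))
    (h3 : ∀ a b, p a → p b → p (a + b)) (h4 : ∀ (c : F) a, p a → p (c • a)) (a : P.KerCoord) :
    p a := by
  obtain ⟨r, rfl⟩ := Ideal.Quotient.mk_surjective a
  induction r using MonoidAlgebra.induction_linear with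
  | zero => simpa using h4 0 _ (h1 1)
  | add f g hf hg => rw [map_add]; exact h3 _ _ hf hg
  | single h c =>
    have e : (MonoidAlgebra.single h c : MonoidAlgebra F X) = c • MonoidAlgebra.single h 1 := by
      rw [MonoidAlgebra.smul_single, smul_eq_mul, mul_one]
    rw [e]
    exact h4 c _ (h1 h)

/-- The Hopf superalgebra `F[D']` of the purely even supergroup `D'`. -/
def kerHopf : HopfSuperalgebra F P.KerCoord :=
  PurelyEven.hopf F P.KerCoord
    (fun b => by
      induction b using kerCoord_induction with
      | h1 h => simp [HopfAlgebra.Quotient.antipode_mk]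
      | h3 a b ha hb => simp [ha, hb]
      | h4 c a ha => simp [ha])
    (fun b => by
      induction b using kerCoord_induction with
      | h1 h => simp [HopfAlgebra.Quotient.antipode_mk]
      | h3 a b ha hb => simp only [map_add, ha, hb]
      | h4 c a ha => simp only [map_smul, ha])

/-- The restriction homomorphism `F[D_{g,x}] → F[D']`, `h ↦ h`, `z ↦ 0`, as an algebra
homomorphism. -/
def restrictAlgHom : CoordAlg P →ₐ[F] P.KerCoord :=
  ((Ideal.Quotient.mkₐ F P.kerIdeal).comp
    (TrivSqZeroExt.fstHom F (MonoidAlgebra F X) (MonoidAlgebra F X)) :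
      DualNumber (MonoidAlgebra F X) →ₐ[F] P.KerCoord)

@[simp] theorem restrictAlgHom_el (h : X) : P.restrictAlgHom (CoordAlg.el P h) =
    Ideal.Quotient.mk P.kerIdeal (MonoidAlgebra.single h 1) := rfl

@[simp] theorem restrictAlgHom_elz (h : X) : P.restrictAlgHom (CoordAlg.elz P h) = 0 :=
  map_zero (Ideal.Quotient.mk P.kerIdeal)

variable [NeZero (2 : F)]

/-- The restriction homomorphism `F[D_{g,x}] → F[D']`, `h ↦ h`, `z ↦ 0`, which defines `D'` as a
(purely even) subsupergroup of `D_{g,x}`. -/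
def restrictHom : CoordAlg P →ₐc[F] P.KerCoord where
  toFun := P.restrictAlgHom
  map_add' := map_add _
  map_smul' := map_smul P.restrictAlgHom
  map_one' := map_one _
  map_mul' := map_mul _
  counit_comp := CoordAlg.lin_ext
    (fun h => by
      change Coalgebra.counit (R := F) (P.restrictAlgHom (CoordAlg.el P h)) = _
      simp)
    (fun h => by
      change Coalgebra.counit (R := F) (P.restrictAlgHom (CoordAlg.elz P h)) = _
      simp)
  map_comp_comul := CoordAlg.lin_ext
    (fun h => by
      change TensorProduct.map P.restrictAlgHom.toLinearMap P.restrictAlgHom.toLinearMap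
        (Coalgebra.comul (R := F) (CoordAlg.el P h)) =
          Coalgebra.comul (R := F) (P.restrictAlgHom (CoordAlg.el P h))
      simp)
    (fun h => by
      change TensorProduct.map P.restrictAlgHom.toLinearMap P.restrictAlgHom.toLinearMap
        (Coalgebra.comul (R := F) (CoordAlg.elz P h)) =
          Coalgebra.comul (R := F) (P.restrictAlgHom (CoordAlg.elz P h))
      simp)

theorem restrictHom_even (i : ZMod 2) (a : CoordAlg P) (ha : a ∈ (CoordAlg.hopf P).gr i) :
    P.restrictHom a ∈ P.kerHopf.gr i := by
  refine CoordAlg.gr_induction P (p := fun i a => P.restrictAlgHom a ∈ P.kerHopf.gr i)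
    ?_ ?_ ?_ ?_ ?_ ha
  · exact fun h => PurelyEven.mem_zero F _ _
  · intro h; rw [restrictAlgHom_elz]; exact zero_mem _
  · intro i; simp
  · intro i a b h1 h2; rw [map_add]; exact add_mem h1 h2
  · intro i c a h1; rw [map_smul]; exact Submodule.smul_mem _ _ h1

end SuperPair

section SuperPoly

variable (F : Type*) [Field F] {ι : Type*} (p : ι → ZMod 2)

/-- The relations of supercommutativity between the generators of a polynomial superalgebra. -/
inductive SuperPolyRel : FreeAlgebra F ι → FreeAlgebra F ι → Prop
  | comm (i j : ι) : SuperPolyRel (FreeAlgebra.ι F i * FreeAlgebra.ι F j)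
      (((-1 : ℤˣ) ^ (p i * p j)) • (FreeAlgebra.ι F j * FreeAlgebra.ι F i))

/-- The polynomial superalgebra over `F`, freely generated as a supercommutative superalgebra by
generators `x_i` of parity `p i`. (The characteristic of `F` is not `2`, hence `x_i² = 0` for odd
generators.) -/
def SuperPoly : Type _ := RingQuot (SuperPolyRel F p)

namespace SuperPoly

instance : Ring (SuperPoly F p) := inferInstanceAs (Ring (RingQuot (SuperPolyRel F p)))

instance : Algebra F (SuperPoly F p) := inferInstanceAs (Algebra F (RingQuot (SuperPolyRel F p)))

/-- The generator `x_i`. -/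
def X (i : ι) : SuperPoly F p := RingQuot.mkAlgHom F (SuperPolyRel F p) (FreeAlgebra.ι F i)

theorem X_mul_X (i j : ι) : X F p i * X F p j = ((-1 : ℤˣ) ^ (p i * p j)) • (X F p j * X F p i) := by
  have h := RingQuot.mkAlgHom_rel F (SuperPolyRel.comm (F := F) (p := p) i j)
  rw [map_mul, Units.smul_def, map_zsmul, map_mul] at h
  rw [Units.smul_def]
  exact h

variable {F p} in
/-- The universal property of the polynomial superalgebra. -/
def lift {B : Type*} [Ring B] [Algebra F B] (y : ι → B)
    (hy : ∀ i j, y i * y j = ((-1 : ℤˣ) ^ (p i * p j)) • (y j * y i)) : SuperPoly F p →ₐ[F] B :=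
  RingQuot.liftAlgHom F ⟨FreeAlgebra.lift F y, by
    rintro _ _ ⟨i, j⟩
    rw [map_mul, Units.smul_def, map_zsmul, map_mul]
    simpa [Units.smul_def] using hy i j⟩

variable {F p} in
@[simp] theorem lift_X {B : Type*} [Ring B] [Algebra F B] (y : ι → B)
    (hy : ∀ i j, y i * y j = ((-1 : ℤˣ) ^ (p i * p j)) • (y j * y i)) (i : ι) :
    lift y hy (X F p i) = y i := by
  have : lift y hy (X F p i) = FreeAlgebra.lift F y (FreeAlgebra.ι F i) :=
    RingQuot.liftAlgHom_mkAlgHom_apply F _ _ _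
  rw [this, FreeAlgebra.lift_ι_apply]

variable {F p} in
theorem algHom_ext {B : Type*} [Ring B] [Algebra F B] {f g : SuperPoly F p →ₐ[F] B}
    (h : ∀ i, f (X F p i) = g (X F p i)) : f = g :=
  RingQuot.ringQuot_ext' F f g (FreeAlgebra.hom_ext (funext h))

/-- The product of the generators in a list. -/
def word (L : List ι) : SuperPoly F p := (L.map (X F p)).prod

/-- The homogeneous component of degree `d`, spanned by the products of `d` generators. -/
def degPart (d : ℕ) : Submodule F (SuperPoly F p) :=
  Submodule.span F (word F p '' {L | L.length = d})

/-- The component of parity `i`, spanned by the products of generators whose parities add up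
to `i`. -/
def gr (i : ZMod 2) : Submodule F (SuperPoly F p) :=
  Submodule.span F (word F p '' {L | (L.map p).sum = i})

theorem word_mem (L : List ι) : word F p L ∈ gr F p (L.map p).sum :=
  Submodule.subset_span ⟨L, rfl, rfl⟩

theorem X_mem (i : ι) : X F p i ∈ gr F p (p i) := by
  simpa [word] using word_mem F p [i]

instance : SetLike.GradedMonoid (gr F p) where
  one_mem := by simpa [word] using word_mem F p []
  mul_mem i j a b ha hb := by
    have h : gr F p i * gr F p j ≤ gr F p (i + j) := by
      rw [gr, gr, Submodule.span_mul_span, Submodule.span_le]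
      rintro _ ⟨_, ⟨L, hL, rfl⟩, _, ⟨L', hL', rfl⟩, rfl⟩
      have := word_mem F p (L ++ L')
      rw [List.map_append, List.sum_append, hL, hL'] at this
      simpa [word] using this
    exact h (Submodule.mul_mem_mul ha hb)

/-- The algebra homomorphism which decomposes elements by parity. -/
def decomp : SuperPoly F p →ₐ[F] ⨁ i, gr F p i :=
  lift (fun i => DirectSum.of (fun i => gr F p i) (p i) ⟨X F p i, X_mem F p i⟩) (by
    intro i j
    rw [DirectSum.of_mul_of, DirectSum.of_mul_of, Units.smul_def,
      ← map_zsmul (DirectSum.of (fun i => gr F p i) (p j + p i))]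
    refine DirectSum.of_eq_of_gradedMonoid_eq (Sigma.subtype_ext (add_comm _ _) ?_)
    exact X_mul_X F p i j)

theorem decomp_word (L : List ι) : decomp F p (word F p L) =
    DirectSum.of (fun i => gr F p i) (L.map p).sum ⟨word F p L, word_mem F p L⟩ := by
  induction L with
  | nil => exact map_one (decomp F p)
  | cons i L ih =>
    have e : word F p (i :: L) = X F p i * word F p L := by simp [word]
    have : decomp F p (word F p (i :: L)) = decomp F p (X F p i) * decomp F p (word F p L) := by
      rw [← map_mul, e]
    rw [this, ih, decomp, lift_X, DirectSum.of_mul_of]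
    exact DirectSum.of_eq_of_gradedMonoid_eq (Sigma.subtype_ext List.sum_cons.symm e.symm)

theorem decomp_mem (i : ZMod 2) (a : gr F p i) :
    decomp F p a = DirectSum.of (fun i => gr F p i) i a := by
  obtain ⟨a, ha⟩ := a
  induction ha using Submodule.span_induction with
  | mem x hx =>
    obtain ⟨L, rfl, rfl⟩ := hx
    exact decomp_word F p L
  | zero => exact (map_zero _).trans (map_zero _).symm
  | add x y hx hy ihx ihy =>
    simp only [map_add] at *
    rw [ihx, ihy, ← map_add]; rfl
  | smul c x hx ih =>
    simp only [map_smul] at *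
    rw [ih]
    exact (map_smul (DirectSum.lof F (ZMod 2) (fun i => gr F p i) i) c ⟨x, hx⟩).symm

instance : GradedAlgebra (gr F p) :=
  GradedAlgebra.ofAlgHom (gr F p) (decomp F p)
    (algHom_ext fun i => by
      rw [AlgHom.comp_apply, decomp, lift_X, DirectSum.coeAlgHom_of]; rfl)
    (decomp_mem F p)

end SuperPoly

end SuperPoly

section Supermodule

variable {F A B V : Type*} [Field F] [Ring A] [Algebra F A] [Coalgebra F A]
  [Ring B] [Algebra F B] [Coalgebra F B] [AddCommGroup V] [Module F V]

/-- A `G`-supermodule structure on `V`, for the affine supergroup `G` with coordinate Hopf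
superalgebra `H`: the structure of a right supercomodule, that is, a `ℤ/2`-grading on `V` together
with a coassociative and counital coaction `V → V ⊗ A` which is a morphism of superspaces. -/
structure Supermodule (H : HopfSuperalgebra F A) (V : Type*) [AddCommGroup V] [Module F V] where
  gr : ZMod 2 → Submodule F V
  isInternal : DirectSum.IsInternal gr
  coact : V →ₗ[F] V ⊗[F] A
  coact_even : ∀ (i : ZMod 2), ∀ v ∈ gr i, coact v ∈
    ⨆ j : ZMod 2, Submodule.map₂ (TensorProduct.mk F V A) (gr j) (H.gr (i - j))
  coassoc : ∀ v : V, TensorProduct.assoc F V A A (coact.rTensor A (coact v)) =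
    (Coalgebra.comul (R := F) (A := A)).lTensor V (coact v)
  counit_coact : ∀ v : V, (Coalgebra.counit (R := F) (A := A)).lTensor V (coact v) = v ⊗ₜ 1

/-- The restriction of a supermodule along a homomorphism `F[G] → F[G']` of Hopf superalgebras. -/
def Supermodule.restrict {H : HopfSuperalgebra F A} (M : Supermodule H V)
    (H' : HopfSuperalgebra F B) (π : A →ₐc[F] B)
    (hπ : ∀ (i : ZMod 2), ∀ a ∈ H.gr i, π a ∈ H'.gr i) : Supermodule H' V where
  gr := M.gr
  isInternal := M.isInternal
  coact := LinearMap.lTensor V (π : A →ₗ[F] B) ∘ₗ M.coact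
  coact_even i v hv := by
    have h : (⨆ j : ZMod 2, Submodule.map₂ (TensorProduct.mk F V A) (M.gr j) (H.gr (i - j))) ≤
        (⨆ j : ZMod 2, Submodule.map₂ (TensorProduct.mk F V B) (M.gr j) (H'.gr (i - j))).comap
          (LinearMap.lTensor V (π : A →ₗ[F] B)) := by
      refine iSup_le fun j => Submodule.map₂_le.mpr fun w hw a ha => ?_
      exact Submodule.mem_iSup_of_mem j (Submodule.apply_mem_map₂ _ hw (hπ _ a ha))
    exact h (M.coact_even i v hv)
  coassoc v := by
    have h1 : ∀ u : V ⊗[F] A, TensorProduct.assoc F V B B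
        ((LinearMap.lTensor V (π : A →ₗ[F] B) ∘ₗ M.coact).rTensor B
          (LinearMap.lTensor V (π : A →ₗ[F] B) u)) =
        LinearMap.lTensor V (TensorProduct.map (π : A →ₗ[F] B) (π : A →ₗ[F] B))
          (TensorProduct.assoc F V A A (M.coact.rTensor A u)) := by
      intro u
      induction u using TensorProduct.induction_on with
      | zero => simp
      | add u w hu hw => simp only [map_add, hu, hw]
      | tmul w a =>
        simp only [LinearMap.lTensor_tmul, LinearMap.rTensor_tmul, LinearMap.comp_apply]
        generalize M.coact w = t
        induction t using TensorProduct.induction_on with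
        | zero => simp
        | add u w hu hw => simp only [map_add, TensorProduct.add_tmul, hu, hw]
        | tmul w b => simp
    have h2 : ∀ u : V ⊗[F] A, (Coalgebra.comul (R := F) (A := B)).lTensor V
        (LinearMap.lTensor V (π : A →ₗ[F] B) u) =
        LinearMap.lTensor V (TensorProduct.map (π : A →ₗ[F] B) (π : A →ₗ[F] B))
          ((Coalgebra.comul (R := F) (A := A)).lTensor V u) := by
      intro u
      induction u using TensorProduct.induction_on with
      | zero => simp
      | add u w hu hw => simp only [map_add, hu, hw]
      | tmul w a =>
        simp only [LinearMap.lTensor_tmul]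
        exact congrArg (w ⊗ₜ ·) (CoalgHomClass.map_comp_comul_apply π a).symm
    rw [LinearMap.comp_apply, h1, h2, M.coassoc]
  counit_coact v := by
    rw [← M.counit_coact v, LinearMap.comp_apply]
    generalize M.coact v = u
    induction u using TensorProduct.induction_on with
    | zero => simp
    | add u w hu hw => simp only [map_add, hu, hw]
    | tmul w a =>
      simp only [LinearMap.lTensor_tmul]
      exact congrArg (w ⊗ₜ ·) (CoalgHomClass.counit_comp_apply π a)

/-- A homogeneous basis of a superspace, indexed by `ι`. -/
structure HomogBasis (gr : ZMod 2 → Submodule F V) (ι : Type*) where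
  basis : Module.Basis ι F V
  parity : ι → ZMod 2
  mem : ∀ i, basis i ∈ gr (parity i)

namespace Supermodule

variable {H : HopfSuperalgebra F A} (M : Supermodule H V) {ι : Type*} (b : HomogBasis M.gr ι)

/-- The coefficients `a_{ki}` of the coaction `τ(v_i) = ∑_k v_k ⊗ a_{ki}`. -/
def coef (k i : ι) : A :=
  TensorProduct.lid F A ((b.basis.coord k).rTensor A (M.coact (b.basis i)))

/-- The coefficients of the coaction `τ(x_i) = ∑_k x_k ⊗ (-1)^{|v_k|(|v_i|+|v_k|)} s(a_{ik})` on the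
dual basis `x_i` of `V*`. -/
def dualCoef (k i : ι) : A :=
  ((-1 : ℤˣ) ^ (b.parity k * (b.parity i + b.parity k))) • H.antipode (M.coef b i k)

theorem coord_eq_zero {i : ι} {j : ZMod 2} (hij : b.parity i ≠ j) {v : V} (hv : v ∈ M.gr j) :
    b.basis.coord i v = 0 := by
  classical
  let _ := M.isInternal.chooseDecomposition
  have h1 : ∀ w : V, b.basis.coord i (DirectSum.decompose M.gr w (b.parity i) : V) =
      b.basis.coord i w := by
    intro w
    have : b.basis.coord i ∘ₗ (M.gr (b.parity i)).subtype ∘ₗ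
        DirectSum.component F (ZMod 2) (fun j => M.gr j) (b.parity i) ∘ₗ
        (DirectSum.decomposeLinearEquiv M.gr).toLinearMap = b.basis.coord i := by
      refine b.basis.ext fun k => ?_
      change b.basis.coord i (DirectSum.decompose M.gr (b.basis k) (b.parity i) : V) =
        b.basis.coord i (b.basis k)
      by_cases hk : b.parity k = b.parity i
      · rw [DirectSum.decompose_of_mem_same M.gr (hk ▸ b.mem k)]
      · have hki : k ≠ i := fun h => hk (congrArg _ h)
        rw [DirectSum.decompose_of_mem_ne M.gr (b.mem k) hk, map_zero]
        simp [hki]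
    exact LinearMap.congr_fun this w
  rw [← h1 v, DirectSum.decompose_of_mem_ne M.gr hv hij.symm, map_zero]

theorem coef_mem (k i : ι) : M.coef b k i ∈ H.gr (b.parity i + b.parity k) := by
  have h : (⨆ j : ZMod 2, Submodule.map₂ (TensorProduct.mk F V A) (M.gr j)
      (H.gr (b.parity i - j))) ≤ (H.gr (b.parity i + b.parity k)).comap
        ((TensorProduct.lid F A).toLinearMap ∘ₗ (b.basis.coord k).rTensor A) := by
    refine iSup_le fun j => Submodule.map₂_le.mpr fun w hw a ha => ?_
    by_cases hj : b.parity k = j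
    · subst hj
      have e : b.parity i - b.parity k = b.parity i + b.parity k := by
        generalize b.parity i = s; generalize b.parity k = t; revert s t; decide
      rw [e] at ha
      simpa using Submodule.smul_mem _ _ ha
    · have := M.coord_eq_zero b hj hw
      simp only [Module.Basis.coord_apply] at this
      simp [this]
  exact h (M.coact_even _ _ (b.mem i))

theorem dualCoef_mem (k i : ι) : M.dualCoef b k i ∈ H.gr (b.parity i + b.parity k) := by
  rw [dualCoef, Units.smul_def]
  refine zsmul_mem (H.antipode_even _ _ ?_) _
  rw [add_comm]
  exact M.coef_mem b i k

theorem gen_comm [Fintype ι] (i j : ι) :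
    (∑ k, GradedTensorProduct.of F (SuperPoly.gr F b.parity) H.gr
      (SuperPoly.X F b.parity k ⊗ₜ M.dualCoef b k i)) *
    (∑ k, GradedTensorProduct.of F (SuperPoly.gr F b.parity) H.gr
      (SuperPoly.X F b.parity k ⊗ₜ M.dualCoef b k j)) =
    ((-1 : ℤˣ) ^ (b.parity i * b.parity j)) •
    ((∑ k, GradedTensorProduct.of F (SuperPoly.gr F b.parity) H.gr
      (SuperPoly.X F b.parity k ⊗ₜ M.dualCoef b k j)) *
    (∑ k, GradedTensorProduct.of F (SuperPoly.gr F b.parity) H.gr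
      (SuperPoly.X F b.parity k ⊗ₜ M.dualCoef b k i))) := by
  rw [Finset.sum_mul_sum, Finset.sum_mul_sum, Finset.sum_comm, Finset.smul_sum]
  refine Finset.sum_congr rfl fun l _ => ?_
  rw [Finset.smul_sum]
  refine Finset.sum_congr rfl fun k _ => ?_
  rw [gradedTensor_mul _ _ _ (M.dualCoef_mem b k i) (SuperPoly.X_mem F b.parity l),
    gradedTensor_mul _ _ _ (M.dualCoef_mem b l j) (SuperPoly.X_mem F b.parity k),
    SuperPoly.X_mul_X F b.parity k l,
    H.supercomm _ _ _ _ (M.dualCoef_mem b k i) (M.dualCoef_mem b l j)]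
  simp only [Units.smul_def, TensorProduct.tmul_smul, ← TensorProduct.smul_tmul', map_zsmul,
    smul_smul]
  congr 1
  generalize b.parity i = s
  generalize b.parity j = t
  generalize b.parity k = u
  generalize b.parity l = v
  revert s t u v
  decide

/-- The coaction `τ : F[V] → F[V] ⊗ F[G]` on the polynomial superalgebra `F[V]`, the homomorphism
of superalgebras with `τ(x_i) = ∑_k x_k ⊗ (-1)^{|v_k|(|v_i|+|v_k|)} s(a_{ik})`. -/
def polyCoact [Fintype ι] : SuperPoly F b.parity →ₐ[F]
    GradedTensorProduct F (SuperPoly.gr F b.parity) H.gr :=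
  SuperPoly.lift (fun i => ∑ k, GradedTensorProduct.of F (SuperPoly.gr F b.parity) H.gr
    (SuperPoly.X F b.parity k ⊗ₜ M.dualCoef b k i)) (M.gen_comm b)

/-- `f ∈ F[V]` is an (absolute) invariant if `τ(f) = f ⊗ 1`. -/
def IsInvariant [Fintype ι] (f : SuperPoly F b.parity) : Prop :=
  M.polyCoact b f = GradedTensorProduct.of F (SuperPoly.gr F b.parity) H.gr (f ⊗ₜ 1)

/-- `M_{G,V}`: the minimal positive degree in which there is a non-zero homogeneous invariant
of `G` in `F[V]`, and `∞` if there is none. -/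
def minDeg [Fintype ι] : ℕ∞ :=
  ⨅ (d : ℕ) (_ : 0 < d ∧ ∃ f ∈ SuperPoly.degPart F b.parity d, f ≠ 0 ∧ M.IsInvariant b f), (d : ℕ∞)

end Supermodule

end Supermodule

/-- The condition that `V*` is the direct sum of the supermodules `L(h_1), …, L(h_s)`, for the dual
basis `f_{j,0}` (even), `f_{j,1}` (odd), `1 ≤ j ≤ s`, of the given basis of `V`:
`τ(f_{j,0}) = f_{j,0} ⊗ h_j + x(h_j) f_{j,1} ⊗ h_j g z` and
`τ(f_{j,1}) = f_{j,0} ⊗ h_j z + f_{j,1} ⊗ h_j g`. -/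
def Supermodule.DualIsSumL {F X V : Type*} [Field F] [NeZero (2 : F)] [CommGroup X]
    [AddCommGroup V] [Module F V] {P : SuperPair F X} (M : Supermodule (CoordAlg.hopf P) V)
    {ι : Type*} [Fintype ι] (b : HomogBasis M.gr ι) : Prop :=
  ∃ (s : ℕ) (e : Fin s × Fin 2 ≃ ι) (h : Fin s → X), ∀ j : Fin s,
    b.parity (e (j, 0)) = 0 ∧ b.parity (e (j, 1)) = 1 ∧
    M.polyCoact b (SuperPoly.X F b.parity (e (j, 0))) =
      GradedTensorProduct.of F (SuperPoly.gr F b.parity) (CoordAlg.hopf P).gr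
        (SuperPoly.X F b.parity (e (j, 0)) ⊗ₜ CoordAlg.el P (h j) +
          P.x (Additive.ofMul (h j)) •
            (SuperPoly.X F b.parity (e (j, 1)) ⊗ₜ CoordAlg.elz P (h j * P.g))) ∧
    M.polyCoact b (SuperPoly.X F b.parity (e (j, 1))) =
      GradedTensorProduct.of F (SuperPoly.gr F b.parity) (CoordAlg.hopf P).gr
        (SuperPoly.X F b.parity (e (j, 0)) ⊗ₜ CoordAlg.elz P (h j) +
          SuperPoly.X F b.parity (e (j, 1)) ⊗ₜ CoordAlg.el P (h j * P.g))

/-- A `D_{g,x}`-supermodule, restricted to `D'`. -/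
def Supermodule.restrictKer {F X V : Type*} [Field F] [NeZero (2 : F)] [CommGroup X]
    [AddCommGroup V] [Module F V] {P : SuperPair F X} (M : Supermodule (CoordAlg.hopf P) V) :
    Supermodule P.kerHopf V :=
  M.restrict P.kerHopf P.restrictHom P.restrictHom_even

end

/-!
Write the coaction at a vector `a ∈ F[V]` of weight `h` for `D` as `τ(a) = a ⊗ h + a' ⊗ hg⁻¹z`. The
odd derivative `a'` has weight `hg⁻¹`, and its own derivative is `x(h) a`. Here `x(g) = 0`, because
`g² = 1` and the characteristic is not `2`; hence for `h = g` the vector `a'` is invariant. The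
lower bounds hold because an invariant of `D_{g,x}` is one of `D'`. Conversely the Reynolds operator
of the diagonalizable group `D'` turns a nonzero invariant of `D'` into a nonzero vector `a` of the
same degree whose weight lies in `⟨g⟩`.

If `D` is connected, then `FX` has no nontrivial idempotent and `(1 + g) / 2` forces `g = 1`. So `a`
has weight `1 = g`: either `a' = 0` and `a` is invariant, or `a'` is a nonzero invariant.

If `V^*` is a sum of modules `L(h)`, then `a` may be taken to be a word in the generators. Replace
its odd letters by their even partners, which changes the weight by a power of `g`, and square: this
gives a word of weight `1` in even letters, of twice the degree. Exchange its first letter `f_{j,0}`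
for `f_{j,1}`; the weight becomes `g`, so the derivative is invariant, and it is nonzero because
modulo the odd generators it is the even word.
-/

noncomputable section

namespace HopfSuperalgebra

open LinearMap WithConv

variable {F A B : Type*} [Field F] [Ring A] [Algebra F A] [Coalgebra F A]
  [Ring B] [Algebra F B] [Coalgebra F B]

theorem comp_antipode_convMul_self (H : HopfSuperalgebra F A) {C : Type*} [Ring C] [Algebra F C]
    (f : A →ₐ[F] C) :
    toConv (f.toLinearMap ∘ₗ H.antipode.toLinearMap) * toConv f.toLinearMap = 1 := by
  have h : toConv H.antipode.toLinearMap * toConv LinearMap.id = 1 := by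
    ext a
    exact H.antipode_left a
  have h' := algHom_comp_convMul_distrib f (toConv H.antipode.toLinearMap) (toConv LinearMap.id)
  rw [h] at h'
  refine (congrArg toConv h'.symm).trans ?_
  ext a
  exact f.commutes _

theorem counit_antipode (H : HopfSuperalgebra F A) (a : A) :
    Coalgebra.counit (R := F) (H.antipode a) = Coalgebra.counit (R := F) a := by
  let ε : A →ₐ[F] F := AlgHom.ofLinearMap Coalgebra.counit H.counit_one H.counit_mul
  have hε : toConv ε.toLinearMap = 1 := by
    ext
    rfl
  have h := H.comp_antipode_convMul_self ε
  rw [hε, mul_one] at h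
  exact LinearMap.congr_fun (toConv_injective h) a

theorem map_antipode (H : HopfSuperalgebra F A) (H' : HopfSuperalgebra F B) (π : A →ₐc[F] B)
    (a : A) : π (H.antipode a) = H'.antipode (π a) := by
  let f : A →ₐ[F] B := π
  have h : toConv LinearMap.id * toConv H'.antipode.toLinearMap = 1 := by
    ext b
    exact H'.antipode_right b
  have h' := convMul_comp_coalgHom_distrib (toConv LinearMap.id)
    (toConv H'.antipode.toLinearMap) (π : A →ₗc[F] B)
  rw [h] at h'
  have hr : toConv f.toLinearMap * toConv (H'.antipode.toLinearMap ∘ₗ f.toLinearMap) = 1 := by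
    refine (congrArg toConv h'.symm).trans ?_
    ext b
    exact congrArg (algebraMap F B) (CoalgHomClass.counit_comp_apply π b)
  exact LinearMap.congr_fun
    (toConv_injective (left_inv_eq_right_inv (H.comp_antipode_convMul_self f) hr)) a

end HopfSuperalgebra

namespace SuperPoly

variable (F : Type*) [Field F] {ι : Type*} (p : ι → ZMod 2)

theorem word_cons (i : ι) (L : List ι) : word F p (i :: L) = X F p i * word F p L := by
  simp [word]

theorem X_mem_degPart (i : ι) : X F p i ∈ degPart F p 1 :=
  Submodule.subset_span ⟨[i], rfl, by simp [word]⟩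

variable {F p} in
theorem mul_mem_degPart {m n : ℕ} {a b : SuperPoly F p} (ha : a ∈ degPart F p m)
    (hb : b ∈ degPart F p n) : a * b ∈ degPart F p (m + n) := by
  have h : degPart F p m * degPart F p n ≤ degPart F p (m + n) := by
    rw [degPart, degPart, Submodule.span_mul_span, Submodule.span_le]
    rintro _ ⟨_, ⟨L, rfl, rfl⟩, _, ⟨L', rfl, rfl⟩, rfl⟩
    exact Submodule.subset_span ⟨L ++ L', List.length_append, by simp [word]⟩
  exact h (Submodule.mul_mem_mul ha hb)

/-- The homomorphism of `F[V]` onto the polynomial algebra in the even generators, killing the odd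
ones. It serves to show that an element of `F[V]` is non-zero. -/
def evenHom : SuperPoly F p →ₐ[F] MvPolynomial ι F :=
  lift (fun i => if p i = 0 then MvPolynomial.X i else 0) (by
    intro i j
    rcases CoordAlg.zmod2_cases (p i) with hi | hi <;>
      rcases CoordAlg.zmod2_cases (p j) with hj | hj <;> simp [hi, hj, mul_comm])

variable {p} in
theorem evenHom_X_even {i : ι} (hi : p i = 0) : evenHom F p (X F p i) = MvPolynomial.X i := by
  simp [evenHom, hi]

variable {p} in
theorem evenHom_X_odd {i : ι} (hi : p i = 1) : evenHom F p (X F p i) = 0 := by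
  simp [evenHom, hi]

variable {p} in
theorem evenHom_word_ne_zero {L : List ι} (hL : ∀ i ∈ L, p i = 0) :
    evenHom F p (word F p L) ≠ 0 := by
  rw [word, map_list_prod, List.map_map]
  refine List.prod_ne_zero fun h => ?_
  obtain ⟨i, hi, h0⟩ := List.mem_map.mp h
  rw [Function.comp_apply, evenHom_X_even F (hL i hi)] at h0
  exact MvPolynomial.X_ne_zero i h0

end SuperPoly

namespace Supermodule

section Coefficients

variable {F A V ι : Type*} [Field F] [Ring A] [Algebra F A] [Coalgebra F A]
  [AddCommGroup V] [Module F V] {H : HopfSuperalgebra F A} (M : Supermodule H V)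
  (b : HomogBasis M.gr ι)

theorem coact_basis [Fintype ι] (i : ι) :
    M.coact (b.basis i) = ∑ k, b.basis k ⊗ₜ M.coef b k i := by
  have h : ∀ u : V ⊗[F] A, u = ∑ k, b.basis k ⊗ₜ
      TensorProduct.lid F A ((b.basis.coord k).rTensor A u) := by
    intro u
    induction u using TensorProduct.induction_on with
    | zero => simp
    | add u w hu hw =>
      conv_lhs => rw [hu, hw]
      simp only [map_add, TensorProduct.tmul_add, Finset.sum_add_distrib]
    | tmul v a =>
      simp only [LinearMap.rTensor_tmul, TensorProduct.lid_tmul, TensorProduct.tmul_smul,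
        TensorProduct.smul_tmul', ← TensorProduct.sum_tmul]
      congr 1
      exact (b.basis.sum_repr v).symm
  exact h _

theorem comul_coef [Fintype ι] (k i : ι) :
    Coalgebra.comul (R := F) (M.coef b k i) = ∑ l, M.coef b k l ⊗ₜ M.coef b l i := by
  classical
  have h := congrArg (fun u => TensorProduct.lid F (A ⊗[F] A)
    ((b.basis.coord k).rTensor (A ⊗[F] A) u)) (M.coassoc (b.basis i))
  simp only [M.coact_basis b, map_sum, LinearMap.rTensor_tmul, LinearMap.lTensor_tmul,
    TensorProduct.sum_tmul, TensorProduct.assoc_tmul, TensorProduct.lid_tmul,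
    Module.Basis.coord_apply, Module.Basis.repr_self, Finsupp.single_apply, ite_smul, one_smul,
    zero_smul, Finset.sum_ite_eq', Finset.mem_univ, if_true] at h
  simpa using h.symm

theorem counit_coef [DecidableEq ι] (k i : ι) :
    Coalgebra.counit (R := F) (M.coef b k i) = if k = i then 1 else 0 := by
  have hcounit : ∀ u : V ⊗[F] A,
      Coalgebra.counit (R := F) (TensorProduct.lid F A ((b.basis.coord k).rTensor A u)) =
        TensorProduct.lid F F ((b.basis.coord k).rTensor F
          ((Coalgebra.counit (R := F) (A := A)).lTensor V u)) := by
    intro u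
    induction u using TensorProduct.induction_on with
    | zero => simp only [map_zero]
    | add u w hu hw => simp only [map_add, hu, hw]
    | tmul v a => simp
  refine (hcounit (M.coact (b.basis i))).trans ?_
  rw [M.counit_coact]
  simp [Finsupp.single_apply, eq_comm]

theorem comul_dualCoef [Fintype ι] (k i : ι) :
    Coalgebra.comul (R := F) (M.dualCoef b k i) =
      ∑ l, M.dualCoef b k l ⊗ₜ M.dualCoef b l i := by
  refine (GradedTensorProduct.of F H.gr H.gr).injective ?_
  have swap : ∀ l, GradedTensorProduct.comm H.gr H.gr (GradedTensorProduct.of F H.gr H.gr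
      (H.antipode (M.coef b i l) ⊗ₜ H.antipode (M.coef b l k))) =
      ((-1 : ℤˣ) ^ ((b.parity k + b.parity l) * (b.parity l + b.parity i))) •
      GradedTensorProduct.of F H.gr H.gr
        (H.antipode (M.coef b l k) ⊗ₜ H.antipode (M.coef b i l)) := fun l =>
    (GradedTensorProduct.comm_coe_tmul_coe H.gr H.gr
      ⟨_, H.antipode_even _ _ (M.coef_mem b i l)⟩
      ⟨_, H.antipode_even _ _ (M.coef_mem b l k)⟩).trans (by rw [mul_comm])
  have sign : ∀ s t u : ZMod 2,
      (((-1 : ℤˣ) ^ (t * (s + t)) : ℤˣ) : ℤ) * (((-1 : ℤˣ) ^ ((t + u) * (u + s)) : ℤˣ) : ℤ) =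
      (((-1 : ℤˣ) ^ (u * (s + u)) : ℤˣ) : ℤ) * (((-1 : ℤˣ) ^ (t * (u + t)) : ℤˣ) : ℤ) := by
    decide
  simp only [dualCoef, Units.smul_def, map_zsmul, H.comul_antipode, M.comul_coef, map_sum,
    TensorProduct.map_tmul, AlgHom.toLinearMap_apply, swap, Finset.smul_sum,
    TensorProduct.tmul_smul, ← TensorProduct.smul_tmul', smul_smul, sign]

theorem counit_dualCoef [DecidableEq ι] (k i : ι) :
    Coalgebra.counit (R := F) (M.dualCoef b k i) = if k = i then 1 else 0 := by
  rw [dualCoef, Units.smul_def, map_zsmul, H.counit_antipode, counit_coef]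
  by_cases hk : k = i
  · subst hk
    simp [CharTwo.add_self_eq_zero]
  · simp [hk, Ne.symm hk]

theorem polyCoact_X [Fintype ι] (i : ι) : M.polyCoact b (SuperPoly.X F b.parity i) =
    GradedTensorProduct.of F (SuperPoly.gr F b.parity) H.gr
      (∑ k, SuperPoly.X F b.parity k ⊗ₜ M.dualCoef b k i) := by
  rw [polyCoact, SuperPoly.lift_X, map_sum]

end Coefficients

section FormAct

variable {F A V ι : Type*} [Field F] [Ring A] [Algebra F A] [Coalgebra F A]
  [AddCommGroup V] [Module F V] {H : HopfSuperalgebra F A} (M : Supermodule H V) [Fintype ι]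
  (b : HomogBasis M.gr ι)

/-- The action of a linear form `θ` on `F[G]` (a distribution on `G`) on `F[V]`: the coaction
followed by `id ⊗ θ`. -/
def formAct (θ : A →ₗ[F] F) : SuperPoly F b.parity →ₗ[F] SuperPoly F b.parity :=
  (TensorProduct.rid F (SuperPoly F b.parity)).toLinearMap ∘ₗ θ.lTensor (SuperPoly F b.parity) ∘ₗ
    (GradedTensorProduct.of F (SuperPoly.gr F b.parity) H.gr).symm.toLinearMap ∘ₗ
    (M.polyCoact b).toLinearMap

variable {M b} in
theorem formAct_of_polyCoact_eq {f : SuperPoly F b.parity} {u : SuperPoly F b.parity ⊗[F] A}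
    (hf : M.polyCoact b f = GradedTensorProduct.of F (SuperPoly.gr F b.parity) H.gr u)
    (θ : A →ₗ[F] F) :
    M.formAct b θ f = TensorProduct.rid F (SuperPoly F b.parity) (θ.lTensor _ u) := by
  simp [formAct, hf]

variable {M b} in
theorem IsInvariant.formAct_eq {f : SuperPoly F b.parity} (hf : M.IsInvariant b f)
    (θ : A →ₗ[F] F) : M.formAct b θ f = θ 1 • f := by
  simp [formAct_of_polyCoact_eq hf]

theorem formAct_X (θ : A →ₗ[F] F) (i : ι) : M.formAct b θ (SuperPoly.X F b.parity i) =
    ∑ k, θ (M.dualCoef b k i) • SuperPoly.X F b.parity k := by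
  simp [formAct_of_polyCoact_eq (M.polyCoact_X b i)]

theorem formAct_counit_X (i : ι) :
    M.formAct b Coalgebra.counit (SuperPoly.X F b.parity i) = SuperPoly.X F b.parity i := by
  classical
  simp [formAct_X, counit_dualCoef]

theorem formAct_X_mem_degPart (θ : A →ₗ[F] F) (i : ι) :
    M.formAct b θ (SuperPoly.X F b.parity i) ∈ SuperPoly.degPart F b.parity 1 := by
  rw [formAct_X]
  exact sum_mem fun k _ => Submodule.smul_mem _ _ (SuperPoly.X_mem_degPart F b.parity k)

theorem formAct_X_mem_gr {θ : A →ₗ[F] F} {j : ZMod 2} (hθ : ∀ a ∈ H.gr (j + 1), θ a = 0) (i : ι) :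
    M.formAct b θ (SuperPoly.X F b.parity i) ∈ SuperPoly.gr F b.parity (b.parity i + j) := by
  rw [formAct_X]
  refine sum_mem fun k _ => ?_
  have parity_cases : ∀ s t u : ZMod 2, t = s + u ∨ s + t = u + 1 := by decide
  rcases parity_cases (b.parity i) (b.parity k) j with hk | hk
  · rw [← hk]
    exact Submodule.smul_mem _ _ (SuperPoly.X_mem F b.parity k)
  · rw [hθ _ (hk ▸ M.dualCoef_mem b k i), zero_smul]
    exact zero_mem _

theorem polyCoact_formAct_X (θ : A →ₗ[F] F) (i : ι) :
    M.polyCoact b (M.formAct b θ (SuperPoly.X F b.parity i)) =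
      GradedTensorProduct.of F (SuperPoly.gr F b.parity) H.gr
        (∑ k, SuperPoly.X F b.parity k ⊗ₜ
          TensorProduct.rid F A (θ.lTensor A (Coalgebra.comul (M.dualCoef b k i)))) := by
  simp only [formAct_X, comul_dualCoef, map_sum, map_smul, polyCoact_X, LinearMap.lTensor_tmul,
    TensorProduct.rid_tmul, TensorProduct.tmul_sum, TensorProduct.tmul_smul, Finset.smul_sum]
  exact Finset.sum_comm

end FormAct

section HasInvariant

variable {F A V ι : Type*} [Field F] [Ring A] [Algebra F A] [Coalgebra F A]
  [AddCommGroup V] [Module F V] {H : HopfSuperalgebra F A} [Fintype ι]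

/-- `F[V]^G` has a non-zero element of degree `d`. -/
def HasInvariant (M : Supermodule H V) (b : HomogBasis M.gr ι) (d : ℕ) : Prop :=
  ∃ f ∈ SuperPoly.degPart F b.parity d, f ≠ 0 ∧ M.IsInvariant b f

theorem minDeg_le_mul_minDeg {B W κ : Type*} [Ring B] [Algebra F B] [Coalgebra F B]
    [AddCommGroup W] [Module F W] [Fintype κ] {H' : HopfSuperalgebra F B} {M : Supermodule H V}
    {b : HomogBasis M.gr ι} {M' : Supermodule H' W} {b' : HomogBasis M'.gr κ} {c : ℕ} (hc : 0 < c)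
    (h : ∀ d, 0 < d → M'.HasInvariant b' d → M.HasInvariant b (c * d)) :
    M.minDeg b ≤ c * M'.minDeg b' := by
  have hc0 : (c : ℕ∞) ≠ 0 := by exact_mod_cast hc.ne'
  simp only [minDeg, ENat.mul_iInf_of_ne hc0]
  refine le_iInf₂ fun d ⟨hd, hf⟩ => ?_
  exact (iInf₂_le (c * d) ⟨Nat.mul_pos hc hd, h d hd hf⟩).trans_eq (Nat.cast_mul c d)

end HasInvariant

end Supermodule

section GradedLTensor

variable {F S A B : Type*} [Field F] [Ring S] [Algebra F S] [Ring A] [Algebra F A] [Ring B]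
  [Algebra F B] (𝒮 : ZMod 2 → Submodule F S) [GradedAlgebra 𝒮]
  (𝒜 : ZMod 2 → Submodule F A) [GradedAlgebra 𝒜] (ℬ : ZMod 2 → Submodule F B) [GradedAlgebra ℬ]
  {Φ : Type*} [FunLike Φ A B] [AlgHomClass Φ F A B] (π : Φ) (hπ : ∀ i, ∀ a ∈ 𝒜 i, π a ∈ ℬ i)

/-- The homomorphism `id ⊗ π` of graded tensor products induced by an even homomorphism `π`. -/
def gradedLTensor : GradedTensorProduct F 𝒮 𝒜 →ₐ[F] GradedTensorProduct F 𝒮 ℬ :=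
  GradedTensorProduct.lift 𝒮 𝒜 (GradedTensorProduct.includeLeft 𝒮 ℬ)
    ((GradedTensorProduct.includeRight 𝒮 ℬ).comp (AlgHomClass.toAlgHom π)) (by
      intro i j s a
      have h : (GradedTensorProduct.of F 𝒮 ℬ (1 ⊗ₜ π a) *
          GradedTensorProduct.of F 𝒮 ℬ ((s : S) ⊗ₜ 1)) =
          (-1 : ℤˣ) ^ (j * i) • GradedTensorProduct.of F 𝒮 ℬ ((s : S) ⊗ₜ π a) := by
        rw [gradedTensor_mul 𝒮 ℬ _ (hπ j a a.2) s.2, one_mul, mul_one]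
      change GradedTensorProduct.of F 𝒮 ℬ ((s : S) ⊗ₜ 1) *
        GradedTensorProduct.of F 𝒮 ℬ (1 ⊗ₜ π a) = (-1 : ℤˣ) ^ (j * i) • (_ * _)
      refine (GradedTensorProduct.tmul_one_mul_one_tmul 𝒮 ℬ (s : S) (π a)).trans ?_
      refine Eq.trans ?_ (congrArg ((-1 : ℤˣ) ^ (j * i) • ·) h).symm
      simp only [smul_smul, Int.units_mul_self, one_smul])

@[simp] theorem gradedLTensor_of (u : S ⊗[F] A) :
    gradedLTensor 𝒮 𝒜 ℬ π hπ (GradedTensorProduct.of F 𝒮 𝒜 u) =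
      GradedTensorProduct.of F 𝒮 ℬ ((AlgHomClass.toAlgHom π).toLinearMap.lTensor S u) := by
  induction u using TensorProduct.induction_on with
  | zero => simp
  | add u v hu hv => simp only [map_add, hu, hv]
  | tmul s a => exact GradedTensorProduct.tmul_one_mul_one_tmul 𝒮 ℬ s (π a)

end GradedLTensor

namespace Supermodule

section Restriction

variable {F A B V ι : Type*} [Field F] [Ring A] [Algebra F A] [Coalgebra F A] [Ring B] [Algebra F B]
  [Coalgebra F B] [AddCommGroup V] [Module F V] {H : HopfSuperalgebra F A} (M : Supermodule H V)
  (H' : HopfSuperalgebra F B) (π : A →ₐc[F] B) (hπ : ∀ i, ∀ a ∈ H.gr i, π a ∈ H'.gr i)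
  (b : HomogBasis M.gr ι)

theorem restrict_coef (k i : ι) : (M.restrict H' π hπ).coef b k i = π (M.coef b k i) := by
  change TensorProduct.lid F B ((b.basis.coord k).rTensor B
    (LinearMap.lTensor V (π : A →ₗ[F] B) (M.coact (b.basis i)))) = _
  rw [coef]
  generalize M.coact (b.basis i) = u
  induction u using TensorProduct.induction_on with
  | zero => simp
  | add u w hu hw => simp only [map_add, hu, hw]
  | tmul v a => simp

theorem restrict_dualCoef (k i : ι) :
    (M.restrict H' π hπ).dualCoef b k i = π (M.dualCoef b k i) := by
  change ((-1 : ℤˣ) ^ (b.parity k * (b.parity i + b.parity k))) •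
    H'.antipode ((M.restrict H' π hπ).coef b i k) = _
  rw [restrict_coef, ← H.map_antipode H' π, dualCoef, Units.smul_def, Units.smul_def, map_zsmul]

variable [Fintype ι]

theorem restrict_polyCoact (f : SuperPoly F b.parity) :
    (M.restrict H' π hπ).polyCoact b f =
      gradedLTensor (SuperPoly.gr F b.parity) H.gr H'.gr π hπ (M.polyCoact b f) := by
  have h : (M.restrict H' π hπ).polyCoact b =
      (gradedLTensor (SuperPoly.gr F b.parity) H.gr H'.gr π hπ).comp
        (M.polyCoact b) := by
    refine SuperPoly.algHom_ext fun i => ?_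
    have hX : gradedLTensor (SuperPoly.gr F b.parity) H.gr H'.gr π hπ
        (M.polyCoact b (SuperPoly.X F b.parity i)) = GradedTensorProduct.of F _ H'.gr
          (∑ k, SuperPoly.X F b.parity k ⊗ₜ π (M.dualCoef b k i)) := by
      rw [polyCoact_X, gradedLTensor_of, map_sum]
      rfl
    refine ((M.restrict H' π hπ).polyCoact_X b i).trans (.trans ?_ hX.symm)
    simp only [restrict_dualCoef]
  exact DFunLike.congr_fun h f

theorem restrict_formAct (θ : B →ₗ[F] F) (f : SuperPoly F b.parity) :
    (M.restrict H' π hπ).formAct b θ f = M.formAct b (θ ∘ₗ (π : A →ₗ[F] B)) f := by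
  obtain ⟨u, hu⟩ := (GradedTensorProduct.of F (SuperPoly.gr F b.parity) H.gr).surjective
    (M.polyCoact b f)
  have hu' : (M.restrict H' π hπ).polyCoact b f = GradedTensorProduct.of F _ H'.gr
      ((π : A →ₗ[F] B).lTensor _ u) :=
    (M.restrict_polyCoact H' π hπ b f).trans
      ((congrArg _ hu.symm).trans (gradedLTensor_of _ _ _ _ _ u))
  rw [formAct_of_polyCoact_eq hu.symm, LinearMap.lTensor_comp_apply]
  exact formAct_of_polyCoact_eq hu' θ

variable {M b} in
theorem IsInvariant.restrict {f : SuperPoly F b.parity} (hf : M.IsInvariant b f) :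
    (M.restrict H' π hπ).IsInvariant b f := by
  refine (M.restrict_polyCoact H' π hπ b f).trans ?_
  rw [hf, gradedLTensor_of, LinearMap.lTensor_tmul]
  exact congrArg (fun a => GradedTensorProduct.of F _ H'.gr (f ⊗ₜ a)) (map_one π)

theorem minDeg_restrict_le : (M.restrict H' π hπ).minDeg b ≤ M.minDeg b := by
  refine le_iInf₂ fun d ⟨hd, f, hf, hf0, hi⟩ => iInf₂_le d ?_
  exact ⟨hd, f, hf, hf0, hi.restrict H' π hπ⟩

end Restriction

end Supermodule

namespace SuperPair

variable {F X : Type*} [Field F] [NeZero (2 : F)] [CommGroup X] (P : SuperPair F X)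

theorem x_ofMul_g : P.x (Additive.ofMul P.g) = 0 := by
  rcases CoordAlg.g_cases P with hx | ⟨-, hx⟩
  · rw [hx, AddMonoidHom.zero_apply]
  · exact hx

theorem x_ofMul_mul_inv_g (h : X) :
    P.x (Additive.ofMul (h * P.g⁻¹)) = P.x (Additive.ofMul h) := by
  rw [ofMul_mul, ofMul_inv, map_add, map_neg, x_ofMul_g, neg_zero, add_zero]

end SuperPair

namespace CoordAlg

variable {F X : Type*} [Field F] [CommGroup X] (P : SuperPair F X)

/-- The coordinate form at the element `h` of the basis of all `h` and `hz`. -/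
def evenCoeff (h : X) : CoordAlg P →ₗ[F] F := by
  classical exact liftLin P (Pi.single h 1) 0

/-- The coordinate form at the element `hz` of the basis of all `h` and `hz`. -/
def oddCoeff (h : X) : CoordAlg P →ₗ[F] F := by
  classical exact liftLin P 0 (Pi.single h 1)

open Classical in
@[simp] theorem evenCoeff_el (h k : X) : evenCoeff P h (el P k) = if k = h then 1 else 0 :=
  (liftLin_el P _ _ k).trans (Pi.single_apply h 1 k)

@[simp] theorem evenCoeff_elz (h k : X) : evenCoeff P h (elz P k) = 0 :=
  liftLin_elz P _ _ k

@[simp] theorem oddCoeff_el (h k : X) : oddCoeff P h (el P k) = 0 :=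
  liftLin_el P _ _ k

open Classical in
@[simp] theorem oddCoeff_elz (h k : X) : oddCoeff P h (elz P k) = if k = h then 1 else 0 :=
  (liftLin_elz P _ _ k).trans (Pi.single_apply h 1 k)

variable {P}

theorem evenCoeff_eq_zero_of_mem_gr {a : CoordAlg P} (ha : a ∈ gr P 1) (h : X) :
    evenCoeff P h a = 0 := by
  have hle : gr P 1 ≤ LinearMap.ker (evenCoeff P h) :=
    Submodule.span_le.mpr (Set.range_subset_iff.mpr (evenCoeff_elz P h))
  exact hle ha

theorem oddCoeff_eq_zero_of_mem_gr {a : CoordAlg P} (ha : a ∈ gr P 0) (h : X) :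
    oddCoeff P h a = 0 := by
  have hle : gr P 0 ≤ LinearMap.ker (oddCoeff P h) :=
    Submodule.span_le.mpr (Set.range_subset_iff.mpr (oddCoeff_el P h))
  exact hle ha

variable [NeZero (2 : F)]

theorem exists_counit_eq_sum_evenCoeff (a : CoordAlg P) : ∃ S : Finset X, ∀ T, S ⊆ T →
    Coalgebra.counit (R := F) a = ∑ h ∈ T, evenCoeff P h a := by
  classical
  induction a using CoordAlg.induction with
  | h1 h => exact ⟨{h}, fun T hT => by simp [Finset.singleton_subset_iff.mp hT]⟩
  | h2 h => exact ⟨∅, fun T _ => by simp⟩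
  | h3 a b ha hb =>
    obtain ⟨S, hS⟩ := ha
    obtain ⟨S', hS'⟩ := hb
    refine ⟨S ∪ S', fun T hT => ?_⟩
    simp only [map_add, Finset.sum_add_distrib, hS T (Finset.union_subset_left hT),
      hS' T (Finset.union_subset_right hT)]
  | h4 c a ha =>
    obtain ⟨S, hS⟩ := ha
    exact ⟨S, fun T hT => by simp only [map_smul, hS T hT, Finset.smul_sum]⟩

theorem rid_lTensor_evenCoeff_comul (h : X) (a : CoordAlg P) :
    TensorProduct.rid F _ ((evenCoeff P h).lTensor _ (Coalgebra.comul (R := F) a)) =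
      evenCoeff P h a • el P h + oddCoeff P (h * P.g⁻¹) a • elz P (h * P.g⁻¹) := by
  induction a using CoordAlg.induction with
  | h1 k => by_cases hk : k = h <;> simp [hk]
  | h2 k => by_cases hk : k = h * P.g⁻¹ <;> simp [hk, ← eq_mul_inv_iff_mul_eq]
  | h3 a b ha hb => simp only [map_add, ha, hb, add_smul]; abel
  | h4 c a ha => simp only [map_smul, ha, smul_add, smul_smul, smul_eq_mul]

theorem rid_lTensor_oddCoeff_comul (h : X) (a : CoordAlg P) :
    TensorProduct.rid F _ ((oddCoeff P h).lTensor _ (Coalgebra.comul (R := F) a)) =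
      oddCoeff P h a • el P h +
        (P.x (Additive.ofMul h) * evenCoeff P (h * P.g⁻¹) a) • elz P (h * P.g⁻¹) := by
  induction a using CoordAlg.induction with
  | h1 k =>
    by_cases hk : k = h * P.g⁻¹ <;> simp [hk, ← eq_mul_inv_iff_mul_eq, P.x_ofMul_g]
  | h2 k => by_cases hk : k = h <;> simp [hk]
  | h3 a b ha hb => simp only [map_add, ha, hb, add_smul, mul_add]; abel
  | h4 c a ha =>
    simp only [map_smul, ha, smul_add, smul_smul, smul_eq_mul, mul_left_comm]

end CoordAlg

section WeightTensor

variable {F X S : Type*} [Field F] [NeZero (2 : F)] [CommGroup X] [Ring S] [Algebra F S]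
  (𝒮 : ZMod 2 → Submodule F S) [GradedAlgebra 𝒮] (P : SuperPair F X)

/-- The element `a ⊗ h + a' ⊗ hg⁻¹z` of `S ⊗ F[D_{g,x}]` attached to `(a, a')`. It is the shape of
the coaction at an element `a` of weight `h` whose odd derivative is `a'`. -/
def weightTensor (h : X) : S × S →ₗ[F] GradedTensorProduct F 𝒮 (CoordAlg.hopf P).gr :=
  (GradedTensorProduct.of F 𝒮 (CoordAlg.hopf P).gr).toLinearMap ∘ₗ
    ((TensorProduct.mk F S (CoordAlg P)).flip (CoordAlg.el P h)).coprod
      ((TensorProduct.mk F S (CoordAlg P)).flip (CoordAlg.elz P (h * P.g⁻¹)))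

theorem weightTensor_apply (h : X) (a a' : S) : weightTensor 𝒮 P h (a, a') =
    GradedTensorProduct.of F 𝒮 (CoordAlg.hopf P).gr
      (a ⊗ₜ CoordAlg.el P h + a' ⊗ₜ CoordAlg.elz P (h * P.g⁻¹)) := rfl

theorem weightTensor_mul_weightTensor (h k : X) (a a' : S) {j : ZMod 2} {c c' : S} (hc : c ∈ 𝒮 j)
    (hc' : c' ∈ 𝒮 (j + 1)) :
    weightTensor 𝒮 P h (a, a') * weightTensor 𝒮 P k (c, c') =
      weightTensor 𝒮 P (h * k) (a * c, a * c' + (-1 : ℤˣ) ^ j • (a' * c)) := by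
  have el_mem : ∀ l, CoordAlg.el P l ∈ (CoordAlg.hopf P).gr 0 := CoordAlg.el_mem P
  have elz_mem : ∀ l, CoordAlg.elz P l ∈ (CoordAlg.hopf P).gr 1 := CoordAlg.elz_mem P
  simp only [weightTensor_apply, map_add, add_mul, mul_add,
    gradedTensor_mul _ _ _ (el_mem _) hc, gradedTensor_mul _ _ _ (elz_mem _) hc,
    gradedTensor_mul _ _ _ (el_mem _) hc', gradedTensor_mul _ _ _ (elz_mem _) hc',
    CoordAlg.el_mul_el, CoordAlg.el_mul_elz, CoordAlg.elz_mul_el, CoordAlg.elz_mul_elz,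
    TensorProduct.tmul_zero, map_zero, smul_zero, add_zero, TensorProduct.add_tmul]
  simp only [Units.smul_def, ← TensorProduct.smul_tmul', map_zsmul, zero_mul, one_mul,
    uzpow_zero, one_smul, ← mul_assoc, mul_right_comm _ P.g⁻¹, add_zero]
  abel

end WeightTensor

namespace Supermodule

section IsWeightPair

variable {F X V ι : Type*} [Field F] [NeZero (2 : F)] [CommGroup X]
  [AddCommGroup V] [Module F V] [Fintype ι] {P : SuperPair F X}
  (M : Supermodule (CoordAlg.hopf P) V) (b : HomogBasis M.gr ι)

/-- `a ∈ F[V]` is homogeneous of degree `d`, of parity `i` and of weight `h` for the action of `D`,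
and `a'` is its image under the odd superderivation of `F[V]` given by the coefficients of the
coaction at the elements `kz`. -/
structure IsWeightPair (h : X) (i : ZMod 2) (d : ℕ) (a a' : SuperPoly F b.parity) : Prop where
  mem_gr : a ∈ SuperPoly.gr F b.parity i
  mem_gr' : a' ∈ SuperPoly.gr F b.parity (i + 1)
  mem_degPart : a ∈ SuperPoly.degPart F b.parity d
  mem_degPart' : a' ∈ SuperPoly.degPart F b.parity d
  coact : M.polyCoact b a = weightTensor (SuperPoly.gr F b.parity) P h (a, a')
  coact' : M.polyCoact b a' =
    weightTensor (SuperPoly.gr F b.parity) P (h * P.g⁻¹) (a', P.x (Additive.ofMul h) • a)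

namespace IsWeightPair

variable {M b} {h k : X} {i j : ZMod 2} {d m n : ℕ} {a a' c c' : SuperPoly F b.parity}

theorem one : M.IsWeightPair b 1 0 0 1 0 where
  mem_gr := SetLike.GradedOne.one_mem
  mem_gr' := zero_mem _
  mem_degPart := Submodule.subset_span ⟨[], rfl, rfl⟩
  mem_degPart' := zero_mem _
  coact := by
    rw [map_one, weightTensor_apply, TensorProduct.zero_tmul, add_zero]
    rfl
  coact' := by rw [map_zero, ofMul_one, map_zero, zero_smul, Prod.mk_zero_zero, map_zero]

theorem mul (ha : M.IsWeightPair b h i m a a') (hc : M.IsWeightPair b k j n c c') :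
    M.IsWeightPair b (h * k) (i + j) (m + n) (a * c) (a * c' + (-1 : ℤˣ) ^ j • (a' * c)) where
  mem_gr := SetLike.GradedMul.mul_mem ha.mem_gr hc.mem_gr
  mem_gr' := by
    refine add_mem ?_ ?_
    · rw [add_assoc]
      exact SetLike.GradedMul.mul_mem ha.mem_gr hc.mem_gr'
    · rw [Units.smul_def, add_right_comm]
      exact zsmul_mem (SetLike.GradedMul.mul_mem ha.mem_gr' hc.mem_gr) _
  mem_degPart := SuperPoly.mul_mem_degPart ha.mem_degPart hc.mem_degPart
  mem_degPart' := by
    refine add_mem (SuperPoly.mul_mem_degPart ha.mem_degPart hc.mem_degPart') ?_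
    rw [Units.smul_def]
    exact zsmul_mem (SuperPoly.mul_mem_degPart ha.mem_degPart' hc.mem_degPart) _
  coact := by
    rw [map_mul, ha.coact, hc.coact,
      weightTensor_mul_weightTensor _ P h k a a' hc.mem_gr hc.mem_gr']
  coact' := by
    have hc'' : P.x (Additive.ofMul k) • c ∈ SuperPoly.gr F b.parity (j + 1 + 1) := by
      rw [add_assoc, CharTwo.add_self_eq_zero, add_zero]
      exact Submodule.smul_mem _ _ hc.mem_gr
    rw [map_add, Units.smul_def, map_zsmul, map_mul, map_mul, ha.coact, hc.coact', ha.coact',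
      hc.coact, weightTensor_mul_weightTensor _ P _ _ _ _ hc.mem_gr' hc'',
      weightTensor_mul_weightTensor _ P _ _ _ _ hc.mem_gr hc.mem_gr', ← mul_assoc,
      mul_right_comm h, ← map_zsmul, ← map_add, Prod.smul_mk, Prod.mk_add_mk]
    congr 2
    rw [ofMul_mul, map_add, add_smul, smul_add, smul_mul_assoc, mul_smul_comm, Units.smul_def,
      Units.smul_def, smul_smul]
    rcases CoordAlg.zmod2_cases j with rfl | rfl
    · simp
      abel
    · simp [CharTwo.add_self_eq_zero]
      abel

theorem snd (ha : M.IsWeightPair b h i d a a') :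
    M.IsWeightPair b (h * P.g⁻¹) (i + 1) d a' (P.x (Additive.ofMul h) • a) where
  mem_gr := ha.mem_gr'
  mem_gr' := by
    rw [add_assoc, CharTwo.add_self_eq_zero, add_zero]
    exact Submodule.smul_mem _ _ ha.mem_gr
  mem_degPart := ha.mem_degPart'
  mem_degPart' := Submodule.smul_mem _ _ ha.mem_degPart
  coact := ha.coact'
  coact' := by
    rw [map_smul, ha.coact, P.x_ofMul_mul_inv_g, ← map_smul, Prod.smul_mk]
    rcases CoordAlg.g_cases P with hx | ⟨hg, -⟩
    · simp only [hx, AddMonoidHom.zero_apply, zero_smul, Prod.mk_zero_zero, map_zero]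
    · rw [mul_assoc, ← mul_inv, hg, inv_one, mul_one]

theorem isInvariant (ha : M.IsWeightPair b 1 i d a 0) : M.IsInvariant b a := by
  rw [IsInvariant, ha.coact, weightTensor_apply, TensorProduct.zero_tmul, add_zero]
  rfl

theorem isInvariant_snd (ha : M.IsWeightPair b P.g i d a a') : M.IsInvariant b a' := by
  have ha' := ha.snd
  rw [mul_inv_cancel, P.x_ofMul_g, zero_smul] at ha'
  exact ha'.isInvariant

theorem formAct_eq (ha : M.IsWeightPair b h i d a a') (θ : CoordAlg P →ₗ[F] F) :
    M.formAct b θ a = θ (CoordAlg.el P h) • a + θ (CoordAlg.elz P (h * P.g⁻¹)) • a' := by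
  rw [formAct_of_polyCoact_eq (ha.coact.trans (weightTensor_apply _ P h a a'))]
  simp

end IsWeightPair

theorem polyCoact_formAct_evenCoeff_X (h : X) (i : ι) :
    M.polyCoact b (M.formAct b (CoordAlg.evenCoeff P h) (SuperPoly.X F b.parity i)) =
      weightTensor (SuperPoly.gr F b.parity) P h
        (M.formAct b (CoordAlg.evenCoeff P h) (SuperPoly.X F b.parity i),
          M.formAct b (CoordAlg.oddCoeff P (h * P.g⁻¹)) (SuperPoly.X F b.parity i)) := by
  rw [polyCoact_formAct_X, weightTensor_apply]
  simp only [CoordAlg.rid_lTensor_evenCoeff_comul, TensorProduct.tmul_add,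
    TensorProduct.tmul_smul, TensorProduct.smul_tmul', Finset.sum_add_distrib, formAct_X,
    TensorProduct.sum_tmul]

theorem polyCoact_formAct_oddCoeff_X (h : X) (i : ι) :
    M.polyCoact b (M.formAct b (CoordAlg.oddCoeff P h) (SuperPoly.X F b.parity i)) =
      weightTensor (SuperPoly.gr F b.parity) P h
        (M.formAct b (CoordAlg.oddCoeff P h) (SuperPoly.X F b.parity i),
          P.x (Additive.ofMul h) •
            M.formAct b (CoordAlg.evenCoeff P (h * P.g⁻¹)) (SuperPoly.X F b.parity i)) := by
  rw [polyCoact_formAct_X, weightTensor_apply]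
  simp only [CoordAlg.rid_lTensor_oddCoeff_comul, TensorProduct.tmul_add,
    TensorProduct.tmul_smul, TensorProduct.smul_tmul', Finset.sum_add_distrib, formAct_X,
    TensorProduct.sum_tmul, Finset.smul_sum, mul_smul]

theorem isWeightPair_formAct_X (h : X) (i : ι) :
    M.IsWeightPair b h (b.parity i) 1
      (M.formAct b (CoordAlg.evenCoeff P h) (SuperPoly.X F b.parity i))
      (M.formAct b (CoordAlg.oddCoeff P (h * P.g⁻¹)) (SuperPoly.X F b.parity i)) where
  mem_gr := by
    have hX := M.formAct_X_mem_gr b (θ := CoordAlg.evenCoeff P h) (j := 0)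
      (fun a ha => CoordAlg.evenCoeff_eq_zero_of_mem_gr ha h) i
    rwa [add_zero] at hX
  mem_gr' := M.formAct_X_mem_gr b (j := 1)
    (fun a ha => CoordAlg.oddCoeff_eq_zero_of_mem_gr ha (h * P.g⁻¹)) i
  mem_degPart := M.formAct_X_mem_degPart b _ i
  mem_degPart' := M.formAct_X_mem_degPart b _ i
  coact := M.polyCoact_formAct_evenCoeff_X b h i
  coact' := by
    rw [polyCoact_formAct_oddCoeff_X, P.x_ofMul_mul_inv_g]
    rcases CoordAlg.g_cases P with hx | ⟨hg, -⟩
    · simp only [hx, AddMonoidHom.zero_apply, zero_smul]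
    · rw [mul_assoc h, ← mul_inv, hg, inv_one, mul_one]

/-- The span of the weight vectors of degree `d` which are homogeneous for the parity. -/
def weightSpan (d : ℕ) : Submodule F (SuperPoly F b.parity) :=
  Submodule.span F {a | ∃ h i a', M.IsWeightPair b h i d a a'}

theorem X_mem_weightSpan (i : ι) : SuperPoly.X F b.parity i ∈ M.weightSpan b 1 := by
  classical
  choose S hS using fun k => CoordAlg.exists_counit_eq_sum_evenCoeff (M.dualCoef b k i)
  have hX : SuperPoly.X F b.parity i = ∑ h ∈ Finset.univ.biUnion S,
      M.formAct b (CoordAlg.evenCoeff P h) (SuperPoly.X F b.parity i) := by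
    conv_lhs => rw [← M.formAct_counit_X b i]
    simp only [formAct_X]
    rw [Finset.sum_comm]
    simp only [← Finset.sum_smul, ← hS _ _ (Finset.subset_biUnion_of_mem S (Finset.mem_univ _))]
  rw [hX]
  exact sum_mem fun h _ => Submodule.subset_span ⟨_, _, _, M.isWeightPair_formAct_X b h i⟩

theorem degPart_le_weightSpan (d : ℕ) : SuperPoly.degPart F b.parity d ≤ M.weightSpan b d := by
  have hmul (m n : ℕ) : M.weightSpan b m * M.weightSpan b n ≤ M.weightSpan b (m + n) := by
    rw [weightSpan, weightSpan, Submodule.span_mul_span, Submodule.span_le]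
    rintro _ ⟨_, ⟨h, i, a', ha⟩, _, ⟨k, j, c', hc⟩, rfl⟩
    exact Submodule.subset_span ⟨_, _, _, ha.mul hc⟩
  rw [SuperPoly.degPart, Submodule.span_le]
  rintro _ ⟨L, rfl, rfl⟩
  induction L with
  | nil => exact Submodule.subset_span ⟨_, _, _, IsWeightPair.one⟩
  | cons i L ih =>
    rw [SuperPoly.word_cons, List.length_cons, add_comm]
    exact hmul _ _ (Submodule.mul_mem_mul (M.X_mem_weightSpan b i) ih)

end IsWeightPair

end Supermodule

theorem eq_zero_or_eq_one_of_isIdempotentElem {R : Type*} [CommRing R]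
    [PreconnectedSpace (PrimeSpectrum R)] {e : R} (he : IsIdempotentElem e) : e = 0 ∨ e = 1 := by
  rcases isClopen_iff.mp (PrimeSpectrum.isClopen_iff.mpr ⟨e, he, rfl⟩) with h | h
  · exact Or.inl (PrimeSpectrum.basicOpen_injOn_isIdempotentElem he IsIdempotentElem.zero
      (TopologicalSpace.Opens.ext (by simpa using h)))
  · exact Or.inr (PrimeSpectrum.basicOpen_injOn_isIdempotentElem he IsIdempotentElem.one
      (TopologicalSpace.Opens.ext (by simpa using h)))

theorem eq_neg_one_or_eq_one_of_mul_self_eq_one {R : Type*} [CommRing R] [Invertible (2 : R)]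
    [PreconnectedSpace (PrimeSpectrum R)] {u : R} (hu : u * u = 1) : u = -1 ∨ u = 1 := by
  have h2 : ⅟(2 : R) * 2 = 1 := invOf_mul_self _
  have he : IsIdempotentElem (⅟(2 : R) * (1 + u)) := by
    rw [IsIdempotentElem]
    linear_combination (⅟(2 : R)) ^ 2 * hu + ⅟(2 : R) * (1 + u) * h2
  refine (eq_zero_or_eq_one_of_isIdempotentElem he).imp (fun h => ?_) fun h => ?_
  · linear_combination 2 * h - (1 + u) * h2
  · linear_combination 2 * h - (1 + u) * h2

theorem prod_map_append_self_eq_one {G ι κ : Type*} [CommGroup G] {g : G} (hg : g ^ 2 = 1)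
    {w : ι → G} {h : κ → G} {p : ι → κ} (hp : ∀ i, w i * w i = h (p i) * h (p i)) {L : List ι}
    (hL : (L.map w).prod ∈ Subgroup.zpowers g) : ((L.map p ++ L.map p).map h).prod = 1 := by
  calc
    ((L.map p ++ L.map p).map h).prod = (L.map fun i => h (p i) * h (p i)).prod := by
      rw [List.map_append, List.prod_append, List.map_map, List.prod_map_mul]
      rfl
    _ = (L.map w).prod ^ 2 := by simp_rw [← hp, List.prod_map_mul, pow_two]
    _ = 1 := orderOf_dvd_iff_pow_eq_one.mp
      ((orderOf_dvd_of_mem_zpowers hL).trans (orderOf_dvd_of_pow_eq_one hg))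

namespace SuperPair

variable {F X : Type*} [Field F] [CommGroup X] (P : SuperPair F X)

theorem g_eq_one_of_preconnectedSpace [NeZero (2 : F)] (hg : P.g ^ 2 = 1)
    [PreconnectedSpace (PrimeSpectrum (MonoidAlgebra F X))] : P.g = 1 := by
  let _ : Invertible (2 : F) := invertibleOfNonzero (NeZero.ne 2)
  let _ : Invertible (2 : MonoidAlgebra F X) :=
    (Invertible.map (algebraMap F (MonoidAlgebra F X)) 2).copy _ (map_ofNat _ 2).symm
  have hu : (MonoidAlgebra.single P.g 1 * MonoidAlgebra.single P.g 1 : MonoidAlgebra F X) = 1 := by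
    rw [MonoidAlgebra.single_mul_single, ← pow_two, hg, mul_one, MonoidAlgebra.one_def]
  by_contra hne
  have hcoeff : (MonoidAlgebra.single P.g 1 : MonoidAlgebra F X).coeff P.g = 1 := by simp
  rcases eq_neg_one_or_eq_one_of_mul_self_eq_one hu with h | h <;> rw [h] at hcoeff <;>
    simp [MonoidAlgebra.one_def, Ne.symm hne] at hcoeff

/-- The homomorphism from `F[D'] = FX / FX(g - 1)` to the group algebra of `X / ⟨g⟩` induced by the
projection of `X`. -/
def kerCoordHom : P.KerCoord →ₐ[F] MonoidAlgebra F (X ⧸ Subgroup.zpowers P.g) :=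
  Ideal.Quotient.liftₐ P.kerIdeal
    (MonoidAlgebra.mapDomainAlgHom F F (QuotientGroup.mk' (Subgroup.zpowers P.g))) (by
      have hle : P.kerIdeal ≤ RingHom.ker (MonoidAlgebra.mapDomainAlgHom F F
          (QuotientGroup.mk' (Subgroup.zpowers P.g))) := by
        rw [kerIdeal, Ideal.span_le, Set.singleton_subset_iff, SetLike.mem_coe, RingHom.mem_ker,
          map_sub, map_one, sub_eq_zero]
        simp [MonoidAlgebra.one_def, (QuotientGroup.eq_one_iff P.g).mpr]
      exact fun a ha => hle ha)

/-- The linear form on `F[D']` which takes the value `1` at `h ∈ ⟨g⟩` and `0` at `h ∉ ⟨g⟩`. It is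
the integral of the diagonalizable group `D'`. -/
def kerCoordForm : P.KerCoord →ₗ[F] F :=
  Finsupp.lapply 1 ∘ₗ (MonoidAlgebra.coeffLinearEquiv F).toLinearMap ∘ₗ P.kerCoordHom.toLinearMap

theorem kerCoordForm_mk_single (h : X) [Decidable (h ∈ Subgroup.zpowers P.g)] :
    P.kerCoordForm (Ideal.Quotient.mk P.kerIdeal (MonoidAlgebra.single h 1)) =
      if h ∈ Subgroup.zpowers P.g then 1 else 0 := by
  classical
  have hHom : P.kerCoordHom (Ideal.Quotient.mk P.kerIdeal (MonoidAlgebra.single h 1)) =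
      MonoidAlgebra.single (h : X ⧸ Subgroup.zpowers P.g) 1 := by
    change MonoidAlgebra.mapDomainAlgHom F F (QuotientGroup.mk' (Subgroup.zpowers P.g))
      (MonoidAlgebra.single h 1) = _
    simp
  refine (congrArg (fun a => MonoidAlgebra.coeff a 1) hHom).trans ?_
  rw [MonoidAlgebra.coeff_single, Finsupp.single_apply]
  exact if_congr (QuotientGroup.eq_one_iff h) rfl rfl

theorem kerCoordForm_one : P.kerCoordForm 1 = 1 := by
  classical
  have h := P.kerCoordForm_mk_single 1
  rwa [← MonoidAlgebra.one_def, map_one, if_pos (one_mem _)] at h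

end SuperPair

namespace Supermodule

section Invariants

variable {F X V ι : Type*} [Field F] [NeZero (2 : F)] [CommGroup X]
  [AddCommGroup V] [Module F V] [Fintype ι] {P : SuperPair F X}
  (M : Supermodule (CoordAlg.hopf P) V) (b : HomogBasis M.gr ι)

/-- The Reynolds operator of `D'` on `F[V]`. -/
def reynolds : SuperPoly F b.parity →ₗ[F] SuperPoly F b.parity :=
  M.restrictKer.formAct b P.kerCoordForm

variable {M b}

theorem reynolds_eq_self {f : SuperPoly F b.parity} (hf : M.restrictKer.IsInvariant b f) :
    M.reynolds b f = f :=
  (hf.formAct_eq P.kerCoordForm).trans (by rw [P.kerCoordForm_one, one_smul])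

theorem exists_reynolds_ne_zero {S : Set (SuperPoly F b.parity)} {f : SuperPoly F b.parity}
    (hf : f ∈ Submodule.span F S) (hf0 : f ≠ 0) (hi : M.restrictKer.IsInvariant b f) :
    ∃ a ∈ S, M.reynolds b a ≠ 0 := by
  by_contra! h
  have hle : Submodule.span F S ≤ LinearMap.ker (M.reynolds b) := Submodule.span_le.mpr h
  exact hf0 ((reynolds_eq_self hi).symm.trans (hle hf))

theorem IsWeightPair.reynolds_eq_zero {h : X} {i : ZMod 2} {d : ℕ} {a a' : SuperPoly F b.parity}
    (ha : M.IsWeightPair b h i d a a') (hh : h ∉ Subgroup.zpowers P.g) : M.reynolds b a = 0 := by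
  classical
  have hel : P.restrictHom (CoordAlg.el P h) =
    Ideal.Quotient.mk P.kerIdeal (MonoidAlgebra.single h 1) := P.restrictAlgHom_el h
  have helz : P.restrictHom (CoordAlg.elz P (h * P.g⁻¹)) = 0 := P.restrictAlgHom_elz _
  refine (M.restrict_formAct P.kerHopf P.restrictHom P.restrictHom_even b P.kerCoordForm a).trans ?_
  rw [ha.formAct_eq]
  simp [hel, helz, P.kerCoordForm_mk_single, hh]

theorem HasInvariant.of_restrictKer {d : ℕ} (hd : M.restrictKer.HasInvariant b d) (hg : P.g = 1) :
    M.HasInvariant b d := by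
  obtain ⟨f, hf, hf0, hi⟩ := hd
  obtain ⟨a, ⟨h, i, a', ha⟩, ha0⟩ :=
    exists_reynolds_ne_zero (M.degPart_le_weightSpan b d hf) hf0 hi
  obtain rfl : h = 1 := by
    have hh : h ∈ Subgroup.zpowers P.g := by_contra fun hh => ha0 (ha.reynolds_eq_zero hh)
    rwa [hg, Subgroup.zpowers_one_eq_bot, Subgroup.mem_bot] at hh
  by_cases ha' : a' = 0
  · exact ⟨a, ha.mem_degPart, fun h0 => ha0 (by rw [h0, map_zero]), (ha' ▸ ha).isInvariant⟩
  · exact ⟨a', ha.mem_degPart', ha', (hg.symm ▸ ha).isInvariant_snd⟩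

theorem exists_isWeightPair_word {w : ι → X} {L : List ι} (hw : ∀ i ∈ L, ∃ a',
    M.IsWeightPair b (w i) (b.parity i) 1 (SuperPoly.X F b.parity i) a') :
    ∃ a', M.IsWeightPair b (L.map w).prod (L.map b.parity).sum L.length
      (SuperPoly.word F b.parity L) a' := by
  induction L with
  | nil => exact ⟨0, IsWeightPair.one⟩
  | cons i L ih =>
    obtain ⟨a', ha⟩ := hw i List.mem_cons_self
    obtain ⟨c', hc⟩ := ih fun k hk => hw k (List.mem_cons_of_mem i hk)
    rw [List.map_cons, List.prod_cons, List.map_cons, List.sum_cons, SuperPoly.word_cons,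
      List.length_cons, add_comm L.length]
    exact ⟨_, ha.mul hc⟩

theorem HasInvariant.exists_prod_mem_zpowers {d : ℕ} (hd : M.restrictKer.HasInvariant b d)
    {w : ι → X} (hw : ∀ i, ∃ a',
      M.IsWeightPair b (w i) (b.parity i) 1 (SuperPoly.X F b.parity i) a') :
    ∃ L : List ι, L.length = d ∧ (L.map w).prod ∈ Subgroup.zpowers P.g := by
  obtain ⟨f, hf, hf0, hi⟩ := hd
  obtain ⟨_, ⟨L, hL, rfl⟩, h0⟩ := exists_reynolds_ne_zero hf hf0 hi
  obtain ⟨a', ha⟩ := exists_isWeightPair_word (L := L) fun i _ => hw i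
  exact ⟨L, hL, by_contra fun hh => h0 (ha.reynolds_eq_zero hh)⟩

theorem hasInvariant_of_mul_prod_eq_g {i₀ i₁ : ι} (hi₀ : b.parity i₀ = 0) (hi₁ : b.parity i₁ = 1)
    {h : X} (hX : M.IsWeightPair b h 1 1 (SuperPoly.X F b.parity i₁) (SuperPoly.X F b.parity i₀))
    {w : ι → X} {L : List ι} (hL : ∀ i ∈ L, b.parity i = 0)
    (hw : ∀ i ∈ L, ∃ a', M.IsWeightPair b (w i) (b.parity i) 1 (SuperPoly.X F b.parity i) a')
    (hprod : h * (L.map w).prod = P.g) : M.HasInvariant b (1 + L.length) := by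
  obtain ⟨c', hc⟩ := exists_isWeightPair_word hw
  have hsum : (L.map b.parity).sum = 0 := List.sum_eq_zero (by simpa using hL)
  have hu := hX.mul hc
  rw [hprod, hsum, uzpow_zero, one_smul, ← SuperPoly.word_cons] at hu
  refine ⟨_, hu.mem_degPart', fun h0 => ?_, hu.isInvariant_snd⟩
  refine SuperPoly.evenHom_word_ne_zero F (List.forall_mem_cons.mpr ⟨hi₀, hL⟩) ?_
  have heven := congrArg (SuperPoly.evenHom F b.parity) h0
  rwa [map_add, map_mul, SuperPoly.evenHom_X_odd F hi₁, zero_mul, zero_add, map_zero] at heven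

theorem DualIsSumL.exists_isWeightPair (hL : M.DualIsSumL b) (hg : P.g ^ 2 = 1) :
    ∃ (s : ℕ) (e : Fin s × Fin 2 ≃ ι) (h : Fin s → X), ∀ j,
      b.parity (e (j, 0)) = 0 ∧ b.parity (e (j, 1)) = 1 ∧
      M.IsWeightPair b (h j) 0 1 (SuperPoly.X F b.parity (e (j, 0)))
        (P.x (Additive.ofMul (h j)) • SuperPoly.X F b.parity (e (j, 1))) ∧
      M.IsWeightPair b (h j * P.g) 1 1 (SuperPoly.X F b.parity (e (j, 1)))
        (SuperPoly.X F b.parity (e (j, 0))) := by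
  obtain ⟨s, e, h, H⟩ := hL
  refine ⟨s, e, h, fun j => ?_⟩
  obtain ⟨hp0, hp1, hcoact0, hcoact1⟩ := H j
  have hx : P.x (Additive.ofMul (h j * P.g)) = P.x (Additive.ofMul (h j)) := by
    rw [ofMul_mul, map_add, P.x_ofMul_g, add_zero]
  have hinv : P.g⁻¹ = P.g := inv_eq_of_mul_eq_one_left (by rwa [← pow_two])
  have hmem0 := SuperPoly.X_mem F b.parity (e (j, 0))
  have hmem1 := SuperPoly.X_mem F b.parity (e (j, 1))
  rw [hp0] at hmem0
  rw [hp1] at hmem1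
  have hodd : M.IsWeightPair b (h j * P.g) 1 1 (SuperPoly.X F b.parity (e (j, 1)))
      (SuperPoly.X F b.parity (e (j, 0))) :=
    { mem_gr := hmem1
      mem_gr' := hmem0
      mem_degPart := SuperPoly.X_mem_degPart F b.parity _
      mem_degPart' := SuperPoly.X_mem_degPart F b.parity _
      coact := by rw [hcoact1, weightTensor_apply, mul_inv_cancel_right, add_comm]
      coact' := by
        rw [hcoact0, weightTensor_apply, mul_inv_cancel_right, hx, hinv, TensorProduct.smul_tmul'] }
  have heven := hodd.snd
  rw [mul_inv_cancel_right, hx] at heven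
  exact ⟨hp0, hp1, heven, hodd⟩

theorem HasInvariant.two_mul_of_restrictKer {d : ℕ} (hd : M.restrictKer.HasInvariant b d)
    (hd0 : 0 < d) (hg : P.g ^ 2 = 1) (hL : M.DualIsSumL b) : M.HasInvariant b (2 * d) := by
  obtain ⟨s, e, h, H⟩ := hL.exists_isWeightPair hg
  let w : ι → X := fun i => h (e.symm i).1 * P.g ^ ((e.symm i).2 : ℕ)
  have hw0 : ∀ j, w (e (j, 0)) = h j := fun j => by simp [w]
  have hw : ∀ i, ∃ a', M.IsWeightPair b (w i) (b.parity i) 1 (SuperPoly.X F b.parity i) a' := by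
    intro i
    obtain ⟨⟨j, t⟩, rfl⟩ := e.surjective i
    obtain ⟨hp0, hp1, heven, hodd⟩ := H j
    fin_cases t
    · simpa [w, hp0] using ⟨_, heven⟩
    · simpa [w, hp1] using ⟨_, hodd⟩
  obtain ⟨L, rfl, hLg⟩ := hd.exists_prod_mem_zpowers hw
  have hwsq : ∀ i, w i * w i = h (e.symm i).1 * h (e.symm i).1 := fun i => by
    simp only [w]
    rw [mul_mul_mul_comm, ← pow_two (P.g ^ _), pow_right_comm, hg, one_pow, mul_one]
  let K : List (Fin s) := L.map fun i => (e.symm i).1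
  have hK : ((K ++ K).map h).prod = 1 := prod_map_append_self_eq_one hg hwsq hLg
  have hlen : (K ++ K).length = 2 * L.length := by
    rw [List.length_append, List.length_map, two_mul]
  generalize K ++ K = N at hK hlen
  obtain _ | ⟨j, R⟩ := N
  · simp only [List.length_nil] at hlen
    omega
  have hR : ∀ i ∈ R.map fun j => e (j, 0), b.parity i = 0 := by
    simpa using fun j _ => (H j).1
  have hprod : h j * P.g * ((R.map fun j => e (j, 0)).map w).prod = P.g := by
    rw [List.map_map, mul_right_comm]
    simpa [Function.comp_def, hw0] using hK
  obtain ⟨hp0, hp1, -, hodd⟩ := H j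
  have hinv := hasInvariant_of_mul_prod_eq_g hp0 hp1 hodd hR (fun i _ => hw i) hprod
  rwa [List.length_map, add_comm, ← List.length_cons, hlen] at hinv

end Invariants

end Supermodule

end

theorem mainTheorem1_general {F X V ι : Type*} [Field F] [NeZero (2 : F)] [CommGroup X]
    [AddCommGroup V] [Module F V] [Fintype ι] (P : SuperPair F X)
    (M : Supermodule (CoordAlg.hopf P) V) (b : HomogBasis M.gr ι) :
    (P.g = 1 → M.minDeg b = M.restrictKer.minDeg b) ∧
    (P.g ^ 2 = 1 → M.DualIsSumL b →
      M.restrictKer.minDeg b ≤ M.minDeg b ∧ M.minDeg b ≤ 2 * M.restrictKer.minDeg b) := by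
  have hle : M.restrictKer.minDeg b ≤ M.minDeg b :=
    M.minDeg_restrict_le P.kerHopf P.restrictHom P.restrictHom_even b
  refine ⟨fun hg => le_antisymm ?_ hle, fun hg hL => ⟨hle, ?_⟩⟩
  · refine (Supermodule.minDeg_le_mul_minDeg one_pos fun d _ hd => ?_).trans_eq (one_mul _)
    exact (one_mul d).symm ▸ hd.of_restrictKer hg
  · exact Supermodule.minDeg_le_mul_minDeg two_pos fun d hd0 hd =>
      hd.two_mul_of_restrictKer hd0 hg hL

theorem mainTheorem1 {F X V ι : Type*} [Field F] [NeZero (2 : F)] [CommGroup X]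
    [AddCommGroup V] [Module F V] [Fintype ι] (P : SuperPair F X) (hg : P.g ^ 2 = 1)
    (M : Supermodule (CoordAlg.hopf P) V) (b : HomogBasis M.gr ι) :
    (ConnectedSpace (PrimeSpectrum (MonoidAlgebra F X)) →
      M.restrictKer.minDeg b ≤ M.minDeg b ∧ M.minDeg b ≤ 2 * M.restrictKer.minDeg b) ∧
    (M.DualIsSumL b →
      M.restrictKer.minDeg b ≤ M.minDeg b ∧ M.minDeg b ≤ 2 * M.restrictKer.minDeg b) := by
  obtain ⟨heq, hsum⟩ := mainTheorem1_general P M b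
  refine ⟨fun _ => ?_, hsum hg⟩
  rw [heq (P.g_eq_one_of_preconnectedSpace hg), two_mul]
  exact ⟨le_rfl, le_self_add⟩
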